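/- Let $(\mathcal M,\mathfrak g)$ be a finite-dimensional smooth Riemannian manifold without boundary, geodesically complete, so that $\mathrm{Exp}_x$ is defined on all of $T_x\mathcal M$. For a curve $\gamma$, let parallel transport along $\gamma$ be that of the Levi-Civita connection. Let $L>0$ and let $f_1,\dots,f_n:\mathcal M\to\mathbb R$ be differentiable and geodesically $L$-smooth: for every geodesic $\gamma:[0,1]\to\mathcal M$ with $x=\gamma(0)$, $y=\gamma(1)$ (so $\dot\gamma(0)=\mathrm{Exp}_x^{-1}(y)$ when geodesics are unique), $$\|\nabla f_i(x)-\Gamma_y^x\nabla f_i(y)\|\le L\|\dot\gamma(0)\|,$$ where $\Gamma_y^x$ is parallel transport along $\gamma$ from $y$ to $x$. Let $f=\frac1n\sum_{i=1}^n f_i$, let $f^*\in\mathbb R$ satisfy $f(x)\ge f^*$ for all $x\in\mathcal M$, let $x^0\in\mathcal M$ and $\delta^0=f(x^0)-f^*$. Let $b$ be an integer with $1\le b\le\sqrt n$, and put $$p=\frac{b}{n+b},\qquad \eta=\frac{1}{L\left(1+\sqrt{\frac{1-p}{pb}}\right)}.$$ The R-PAGE method with large minibatch size $B=n$ starts with $g^0=\nabla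 f(x^0)$ and iterates $x^{k+1}=\mathrm{Exp}_{x^k}(-\eta g^k)$ and, with fresh independent randomness in each iteration, $$g^{k+1}=\begin{cases}\nabla f(x^{k+1}) & \text{with probability } p,\\ \Gamma_{x^k}^{x^{k+1}}g^k+\frac1b\sum_{i\in I_k}\nabla f_i(x^{k+1})-\Gamma_{x^k}^{x^{k+1}}\Big(\frac1b\sum_{i\in I_k}\nabla f_i(x^k)\Big) & \text{otherwise,}\end{cases}$$ where $I_k$ is a uniformly random $b$-element subset of $\{1,\dots,n\}$ and $\Gamma_{x^k}^{x^{k+1}}$ is parallel transport along the geodesic $t\mapsto\mathrm{Exp}_{x^k}(-t\eta g^k)$, $0\le t\le 1$. For $K\ge1$ let $\widehat x^K$ be chosen uniformly at random from $x^0,\dots,x^{K-1}$, independently of everything else. Then for every $\varepsilon>0$ there is a number of iterations $K\ge1$ such that $$\mathbb E\big[\|\nabla f(\widehat x^K)\|\big]\le\varepsilon,$$ and the expected number $\#\mathrm{grad}$ of evaluations of component gradients $\nabla f_i$ in the initialization and $K$ iterations ($n$ for each full gradient and $2b$ for each minibatch update) satisfies $$\#\mathrm{grad}\le 12\left(n+\frac{L\delta^0\sqrt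 n}{\varepsilon^2}\right).$$ In particular $\#\mathrm{grad}=\mathcal O\left(n+\frac{\sqrt n}{\varepsilon^2}\right)$ for fixed $L$ and $\delta^0$. -/

import Mathlib

open Bundle Manifold MeasureTheory ProbabilityTheory
open scoped ContDiff

noncomputable section

namespace RPAGE

section Geometry

variable {E : Type*} [NormedAddCommGroup E] [NormedSpace ℝ E]
  {M : Type*} [TopologicalSpace M] [ChartedSpace E M] [IsManifold 𝓘(ℝ, E) ∞ M]

/-- The velocity `γ'(t) ∈ T_{γ t} M` of a curve. -/
def velocity (γ : ℝ → M) (t : ℝ) : TangentSpace 𝓘(ℝ, E) (γ t) :=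
  mfderiv 𝓘(ℝ, ℝ) 𝓘(ℝ, E) γ t (1 : ℝ)

/-- Components in `E` of a tangent vector `v ∈ T_p M`, with respect to the chart at `x₀`
(meaningful when `p` lies in the domain of this chart). -/
def coords (x₀ p : M) (v : TangentSpace 𝓘(ℝ, E) p) : E :=
  (trivializationAt E (TangentSpace 𝓘(ℝ, E)) x₀).continuousLinearMapAt ℝ p v

/-- The tangent vector at `p` with components `u` with respect to the chart at `x₀`. -/
def ofCoords (x₀ p : M) (u : E) : TangentSpace 𝓘(ℝ, E) p :=
  (trivializationAt E (TangentSpace 𝓘(ℝ, E)) x₀).symmL ℝ p u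

variable [RiemannianBundle (fun x : M ↦ TangentSpace 𝓘(ℝ, E) x)]

/-- The metric tensor `g_{ij}(y) uⁱ wʲ` in the chart at `x₀`. -/
def metricInChart (x₀ : M) (y u w : E) : ℝ :=
  inner ℝ (ofCoords x₀ ((extChartAt 𝓘(ℝ, E) x₀).symm y) u)
    (ofCoords x₀ ((extChartAt 𝓘(ℝ, E) x₀).symm y) w)

/-- The derivative `∂_a g_{ij} uⁱ wʲ` of the metric tensor in the chart at `x₀`, at `x₀`. -/
def metricDeriv (x₀ : M) (a u w : E) : ℝ :=
  fderiv ℝ (fun y ↦ metricInChart x₀ y u w) (extChartAt 𝓘(ℝ, E) x₀ x₀) a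

/-- The Christoffel symbols of the first kind of the Levi-Civita connection, contracted with
`u`, `v`, `w`: `Γ_{k,ij} uⁱ vʲ wᵏ = ½ (∂_i g_{jk} + ∂_j g_{ik} - ∂_k g_{ij}) uⁱ vʲ wᵏ`,
in the chart at `x₀`, at the point `x₀`. -/
def christoffelFirst (x₀ : M) (u v w : E) : ℝ :=
  (metricDeriv x₀ u v w + metricDeriv x₀ v u w - metricDeriv x₀ w u v) / 2

/-- `V` is a parallel vector field along `γ` over the time set `S`: its covariant derivative
`D_t V` vanishes. At each time `t` this is expressed in the chart at `γ t`, with lowered index: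
`g(V̇, w) + Γ(γ̇, V, w) = 0` for all `w`. -/
def IsParallelOn (γ : ℝ → M) (V : ∀ t, TangentSpace 𝓘(ℝ, E) (γ t)) (S : Set ℝ) : Prop :=
  ∀ t ∈ S, ∃ v' : E,
    HasDerivWithinAt (fun s ↦ coords (γ t) (γ s) (V s)) v' S t ∧
    ∀ w : E, metricInChart (γ t) (extChartAt 𝓘(ℝ, E) (γ t) (γ t)) v' w +
      christoffelFirst (γ t) (coords (γ t) (γ t) (velocity γ t)) (coords (γ t) (γ t) (V t)) w = 0

/-- A (complete) geodesic: a smooth curve with parallel velocity, `D_t γ' = 0`. -/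
def IsGeodesic (γ : ℝ → M) : Prop :=
  ContMDiff 𝓘(ℝ, ℝ) 𝓘(ℝ, E) ∞ γ ∧ IsParallelOn (E := E) γ (velocity γ) Set.univ

/-- `γ` is the geodesic with `γ(0) = x` and `γ'(0) = v`, where `(x, v)` is a point of `TM`. -/
def IsGeodesicFrom (γ : ℝ → M) (xv : TangentBundle 𝓘(ℝ, E) M) : Prop :=
  IsGeodesic (E := E) γ ∧ (⟨γ 0, velocity γ 0⟩ : TangentBundle 𝓘(ℝ, E) M) = xv

variable (E M) in
/-- Geodesic completeness: `Exp_x` is defined on all of `T_x M`, for every `x`. -/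
def IsGeodesicallyComplete : Prop :=
  ∀ xv : TangentBundle 𝓘(ℝ, E) M, ∃ γ : ℝ → M, IsGeodesicFrom γ xv

open Classical in
/-- The geodesic `t ↦ Exp_x(t v)`. -/
def expCurve (xv : TangentBundle 𝓘(ℝ, E) M) : ℝ → M :=
  if h : ∃ γ : ℝ → M, IsGeodesicFrom γ xv then h.choose else fun _ ↦ xv.proj

/-- The Riemannian exponential map `Exp_x(v)`. -/
def riemExp (xv : TangentBundle 𝓘(ℝ, E) M) : M := expCurve xv 1

open Classical in
/-- Parallel transport along `γ` from `γ a` to `γ b` of a tangent vector `u` based at `γ a`: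
the value at time `b` of the parallel field along `γ` whose value at time `a` is `u`. -/
def parallelTransport (γ : ℝ → M) (a b : ℝ) (u : TangentBundle 𝓘(ℝ, E) M) :
    TangentSpace 𝓘(ℝ, E) (γ b) :=
  if h : ∃ V : ∀ t, TangentSpace 𝓘(ℝ, E) (γ t), IsParallelOn γ V (Set.uIcc a b) ∧
      (⟨γ a, V a⟩ : TangentBundle 𝓘(ℝ, E) M) = u
  then h.choose b else 0

variable [FiniteDimensional ℝ E]

instance (x : M) : FiniteDimensional ℝ (TangentSpace 𝓘(ℝ, E) x) :=
  inferInstanceAs (FiniteDimensional ℝ E)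

instance (x : M) : CompleteSpace (TangentSpace 𝓘(ℝ, E) x) :=
  FiniteDimensional.complete ℝ _

/-- The Riemannian gradient: `⟪∇f(x), v⟫ = df_x(v)` for all `v ∈ T_x M`. -/
def riemGrad (f : M → ℝ) (x : M) : TangentSpace 𝓘(ℝ, E) x :=
  (InnerProductSpace.toDual ℝ (TangentSpace 𝓘(ℝ, E) x)).symm (mvfderiv 𝓘(ℝ, E) f x)

variable (E) in
/-- `f` is differentiable and geodesically `L`-smooth: along every geodesic `γ : [0,1] → M` from
`x = γ 0` to `y = γ 1`, so that `γ'(0)` is `Exp_x⁻¹(y)`, one has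
`‖∇f(x) - Γ_y^x ∇f(y)‖ ≤ L ‖Exp_x⁻¹(y)‖`. -/
def IsGSmooth (L : ℝ) (f : M → ℝ) : Prop :=
  MDifferentiable 𝓘(ℝ, E) 𝓘(ℝ, ℝ) f ∧
  ∀ γ : ℝ → M, IsGeodesic (E := E) γ →
    ‖riemGrad (E := E) f (γ 0) - parallelTransport γ 1 0 ⟨γ 1, riemGrad f (γ 1)⟩‖
      ≤ L * ‖velocity (E := E) γ 0‖

/-- The finite-sum objective `f = (1/n) ∑ fᵢ`. -/
def objective {n : ℕ} (f : Fin n → M → ℝ) (x : M) : ℝ := (∑ i, f i x) / n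

/-- The minibatch gradient `(1/|S|) ∑_{i ∈ S} ∇fᵢ(x)`. -/
def batchGrad {n : ℕ} (f : Fin n → M → ℝ) (S : Finset (Fin n)) (x : M) :
    TangentSpace 𝓘(ℝ, E) x :=
  (S.card : ℝ)⁻¹ • ∑ i ∈ S, riemGrad (f i) x

/-- The R-PAGE iterates `(x^k, g^k) ∈ TM` with large minibatch `B = n`, started at `x⁰`, for given
outcomes of the coin flips (`coin k` decides about `g^{k+1}`; `true` means a full gradient) and of
the small minibatches (`batch k` is used for `g^{k+1}`). The transports are along the geodesic
step from `x^k` to `x^{k+1}`. -/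
def iterate {n : ℕ} (f : Fin n → M → ℝ) (η : ℝ) (x₀ : M)
    (coin : ℕ → Bool) (batch : ℕ → Finset (Fin n)) : ℕ → TangentBundle 𝓘(ℝ, E) M
  | 0 => ⟨x₀, batchGrad f Finset.univ x₀⟩
  | k + 1 =>
    let s := iterate f η x₀ coin batch k
    let step : TangentBundle 𝓘(ℝ, E) M := ⟨s.proj, -(η • s.snd)⟩
    let y : M := riemExp step
    let transport : TangentBundle 𝓘(ℝ, E) M → TangentSpace 𝓘(ℝ, E) y :=
      parallelTransport (expCurve step) 0 1
    ⟨y, if coin k then batchGrad f Finset.univ y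
        else transport s + batchGrad f (batch k) y
          - transport ⟨s.proj, batchGrad f (batch k) s.proj⟩⟩

variable (E) in
/-- The output `x̂^K = x^j` of R-PAGE, `j` being the output index. -/
def output {n : ℕ} (f : Fin n → M → ℝ) (η : ℝ) (x₀ : M)
    (coin : ℕ → Bool) (batch : ℕ → Finset (Fin n)) {K : ℕ} (j : Fin K) : M :=
  (iterate (E := E) f η x₀ coin batch j).proj

end Geometry

section Randomness

/-- The number of evaluations of component gradients `∇fᵢ` in the initialization and the first `K`
iterations: `n` for a full gradient, `b` at each of the two points `x^{k+1}`, `x^k` otherwise. -/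
def gradCount (n b : ℕ) (coin : ℕ → Bool) (K : ℕ) : ℕ :=
  n + ∑ k ∈ Finset.range K, if coin k then n else 2 * b

/-- The randomness of R-PAGE with `K` iterations: independent coins with success probability `p`,
independent minibatches uniform among the `b`-element subsets of the `n` indices, and an
independent output index, uniform on `{0, …, K - 1}`. -/
structure IsRandomness {Ω : Type*} [MeasurableSpace Ω] (P : Measure Ω) (n b K : ℕ) (p : ℝ)
    (coin : ℕ → Ω → Bool) (batch : ℕ → Ω → Finset (Fin n)) (idx : Ω → Fin K) : Prop where
  measurable_coin : ∀ k, Measurable (coin k)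
  measurable_batch : ∀ k, Measurable (batch k)
  measurable_idx : Measurable idx
  coin_law : ∀ k, P.real {ξ | coin k ξ = true} = p
  batch_card : ∀ k, ∀ᵐ ξ ∂P, (batch k ξ).card = b
  batch_law : ∀ k, ∀ S : Finset (Fin n), S.card = b →
    P.real {ξ | batch k ξ = S} = 1 / (n.choose b : ℝ)
  idx_law : ∀ j, P.real {ξ | idx ξ = j} = 1 / (K : ℝ)
  indep_coin_batch : ∀ k, IndepFun (coin k) (batch k) P
  indep_iterations : iIndepFun (fun k ξ ↦ (coin k ξ, batch k ξ)) P
  indep_idx : IndepFun idx (fun ξ k ↦ (coin k ξ, batch k ξ)) P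

end Randomness

end RPAGE

end

/-! The quantity that decreases in expectation is the Lyapunov function `potential`, Φ = f − f* +
η/(2p)·‖g − ∇f‖². Descent along the geodesic step bounds f at the new point by f − η⟨∇f, g⟩ +
(Lη²/2)‖g‖². The squared error becomes 0 with probability p; otherwise its mean is at most the old
one plus L²η²‖g‖²/b, by the variance of sampling without replacement. After polarization of ⟨∇f, g⟩
the weight η/(2p) makes the error terms cancel, and the condition on η makes the coefficient of ‖g‖²
nonpositive, so E Φ drops by at least (η/2)·E‖∇f‖² per iteration
(`sum_outcomeWeight_mul_potential_le`). Telescoping bounds the mean of ‖∇f(x̂)‖² by 2δ⁰/(ηK), hence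
by ε² once K ≥ 2δ⁰/(ηε²). An iteration costs 3bn/(n + b) ≤ 3b gradients on average, and b ≤ √n gives
1/η ≤ 2L√n/b, so the product has the stated order.

Most of the geometry serves `transportEquiv`. Parallel transport is defined by choosing a parallel
field, so existence, uniqueness and isometry need proofs. Metric compatibility yields isometry and
uniqueness. Existence comes from the linear equation in one chart, transferred to the moving charts
of `IsParallelOn` by the transformation law of the Christoffel symbols, and then from gluing.

The iterates up to time k are functions of finitely many finite-valued outcomes. Expectations are
therefore finite sums, and no measurability on the manifold is involved. -/

noncomputable section

namespace RPAGE

set_option linter.unusedSectionVars false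
set_option maxSynthPendingDepth 3

/-! ### Tangent coordinates and changes of charts -/

section Charts

variable {E : Type*} [NormedAddCommGroup E] [NormedSpace ℝ E]
  {M : Type*} [TopologicalSpace M] [ChartedSpace E M] [IsManifold 𝓘(ℝ, E) ∞ M]

lemma coords_ofCoords {x₀ p : M} (hp : p ∈ (chartAt E x₀).source) (u : E) :
    coords x₀ p (ofCoords x₀ p u) = u :=
  (trivializationAt E (TangentSpace 𝓘(ℝ, E)) x₀).continuousLinearMapAt_symmL hp u

lemma ofCoords_coords {x₀ p : M} (hp : p ∈ (chartAt E x₀).source)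
    (v : TangentSpace 𝓘(ℝ, E) p) : ofCoords x₀ p (coords x₀ p v) = v :=
  (trivializationAt E (TangentSpace 𝓘(ℝ, E)) x₀).symmL_continuousLinearMapAt hp v

lemma coords_add (x₀ p : M) (v w : TangentSpace 𝓘(ℝ, E) p) :
    coords x₀ p (v + w) = coords x₀ p v + coords x₀ p w := map_add _ _ _

lemma coords_smul (x₀ p : M) (c : ℝ) (v : TangentSpace 𝓘(ℝ, E) p) :
    coords x₀ p (c • v) = c • coords x₀ p v := map_smul _ _ _

/-- The transition map from the chart at `x₀` to the chart at `x₁`. -/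
def transition (x₀ x₁ : M) (y : E) : E :=
  extChartAt 𝓘(ℝ, E) x₁ ((extChartAt 𝓘(ℝ, E) x₀).symm y)

lemma transition_extChartAt {x₀ p : M} (x₁ : M) (hp : p ∈ (chartAt E x₀).source) :
    transition x₀ x₁ (extChartAt 𝓘(ℝ, E) x₀ p) = extChartAt 𝓘(ℝ, E) x₁ p := by
  unfold transition
  rw [(extChartAt 𝓘(ℝ, E) x₀).left_inv (by simpa using hp)]

lemma contDiffAt_transition {x₀ x₁ p : M} (h₀ : p ∈ (chartAt E x₀).source)
    (h₁ : p ∈ (chartAt E x₁).source) :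
    ContDiffAt ℝ ∞ (transition x₀ x₁) (extChartAt 𝓘(ℝ, E) x₀ p) := by
  have := contDiffWithinAt_ext_coord_change (n := ∞) (I := 𝓘(ℝ, E)) x₁ x₀
    (y := extChartAt 𝓘(ℝ, E) x₀ p) (by
      simp only [PartialEquiv.trans_source, PartialEquiv.symm_source, Set.mem_inter_iff,
        Set.mem_preimage]
      refine ⟨(extChartAt 𝓘(ℝ, E) x₀).map_source (by simpa using h₀), ?_⟩
      · rw [(extChartAt 𝓘(ℝ, E) x₀).left_inv (by simpa using h₀)]
        simpa using h₁)
  rwa [modelWithCornersSelf_coe, Set.range_id, contDiffWithinAt_univ] at this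

/-- By the cocycle identity for tangent coordinate changes: going from the chart at `p` to that at
`x₁` factors through the chart at `x₀`. -/
lemma coords_eq_fderiv_transition {x₀ x₁ p : M} (h₀ : p ∈ (chartAt E x₀).source)
    (h₁ : p ∈ (chartAt E x₁).source) (v : TangentSpace 𝓘(ℝ, E) p) :
    coords x₁ p v
      = fderiv ℝ (transition x₀ x₁) (extChartAt 𝓘(ℝ, E) x₀ p) (coords x₀ p v) := by
  have key : ∀ x, p ∈ (chartAt E x).source → coords x p v = tangentCoordChange 𝓘(ℝ, E) p x p v := by
    intro x hx
    unfold coords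
    rw [TangentBundle.continuousLinearMapAt_trivializationAt_eq_core hx]
    rfl
  rw [key x₀ h₀, key x₁ h₁]
  have h := tangentCoordChange_comp (I := 𝓘(ℝ, E)) (w := p) (x := x₀) (y := x₁) (z := p) (v := v)
    ⟨⟨mem_extChartAt_source p, by simpa using h₀⟩, by simpa using h₁⟩
  rw [← h, tangentCoordChange_def (x := x₀)]
  simp only [modelWithCornersSelf_coe, Set.range_id, fderivWithin_univ]
  rfl

lemma coords_velocity {γ : ℝ → M} {x₀ : M} {t : ℝ}
    (hγ : MDifferentiableAt 𝓘(ℝ, ℝ) 𝓘(ℝ, E) γ t) (h₀ : γ t ∈ (chartAt E x₀).source) :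
    HasDerivAt (fun s ↦ extChartAt 𝓘(ℝ, E) x₀ (γ s)) (coords x₀ (γ t) (velocity γ t)) t := by
  have h1 : MDifferentiableAt 𝓘(ℝ, E) 𝓘(ℝ, E) (extChartAt 𝓘(ℝ, E) x₀) (γ t) :=
    mdifferentiableAt_extChartAt h₀
  -- Quantifying over plain maps into `E` lets the tangent spaces in the type of the manifold
  -- derivative unfold definitionally.
  have key : ∀ D : ℝ →L[ℝ] E, HasFDerivAt (fun s ↦ extChartAt 𝓘(ℝ, E) x₀ (γ s)) D t →
      HasDerivAt (fun s ↦ extChartAt 𝓘(ℝ, E) x₀ (γ s)) (D 1) t := fun D h ↦ h.hasDerivAt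
  unfold coords velocity
  rw [TangentBundle.continuousLinearMapAt_trivializationAt h₀]
  exact key _ (h1.hasMFDerivAt.comp t hγ.hasMFDerivAt).hasFDerivAt

end Charts

/-! ### Smoothness of the metric tensor in a chart -/

section Metric

variable {E : Type*} [NormedAddCommGroup E] [NormedSpace ℝ E]
  {M : Type*} [TopologicalSpace M] [ChartedSpace E M] [IsManifold 𝓘(ℝ, E) ∞ M]
  [RiemannianBundle (fun x : M ↦ TangentSpace 𝓘(ℝ, E) x)]

/-- The metric tensor in the chart at `x₀`, as a continuous bilinear form. -/
def metricForm (x₀ : M) (y : E) : E →L[ℝ] E →L[ℝ] ℝ :=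
  (innerSL ℝ (E := TangentSpace 𝓘(ℝ, E) ((extChartAt 𝓘(ℝ, E) x₀).symm y))).bilinearComp
    ((trivializationAt E (TangentSpace 𝓘(ℝ, E)) x₀).symmL ℝ ((extChartAt 𝓘(ℝ, E) x₀).symm y))
    ((trivializationAt E (TangentSpace 𝓘(ℝ, E)) x₀).symmL ℝ ((extChartAt 𝓘(ℝ, E) x₀).symm y))

lemma metricForm_apply (x₀ : M) (y u w : E) :
    metricForm x₀ y u w = metricInChart x₀ y u w := rfl

lemma metricInChart_symm (x₀ : M) (y u w : E) :
    metricInChart x₀ y u w = metricInChart x₀ y w u := real_inner_comm _ _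

lemma inner_eq_metricForm {x₀ p : M} (hp : p ∈ (chartAt E x₀).source)
    (v w : TangentSpace 𝓘(ℝ, E) p) :
    inner ℝ v w = metricForm x₀ (extChartAt 𝓘(ℝ, E) x₀ p) (coords x₀ p v) (coords x₀ p w) := by
  rw [metricForm_apply, metricInChart, (extChartAt 𝓘(ℝ, E) x₀).left_inv (by simpa using hp),
    ofCoords_coords hp, ofCoords_coords hp]

lemma metricForm_pos {x₀ p : M} (hp : p ∈ (chartAt E x₀).source) {u : E} (hu : u ≠ 0) :
    0 < metricForm x₀ (extChartAt 𝓘(ℝ, E) x₀ p) u u := by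
  have h := inner_eq_metricForm hp (ofCoords x₀ p u) (ofCoords x₀ p u)
  rw [coords_ofCoords hp] at h
  rw [← h]
  apply real_inner_self_pos.2
  intro h0
  apply hu
  rw [← coords_ofCoords hp u, h0]
  exact map_zero _

variable [IsContMDiffRiemannianBundle 𝓘(ℝ, E) ∞ E (fun x : M ↦ TangentSpace 𝓘(ℝ, E) x)]

/-- A field with constant components in the chart is a smooth section, and a smooth bundle metric
pairs smooth sections smoothly. -/
lemma contDiffOn_metricInChart (x₀ : M) (u w : E) :
    ContDiffOn ℝ ∞ (fun y ↦ metricInChart x₀ y u w) (extChartAt 𝓘(ℝ, E) x₀).target := by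
  rw [← contMDiffOn_iff_contDiffOn]
  have key : ∀ u : E, ContMDiffOn 𝓘(ℝ, E) (𝓘(ℝ, E).prod 𝓘(ℝ, E)) ∞
      (fun y ↦ (⟨(extChartAt 𝓘(ℝ, E) x₀).symm y, ofCoords x₀ ((extChartAt 𝓘(ℝ, E) x₀).symm y) u⟩ :
        TangentBundle 𝓘(ℝ, E) M)) (extChartAt 𝓘(ℝ, E) x₀).target := by
    intro u
    have h1 : ContMDiffOn 𝓘(ℝ, E) (𝓘(ℝ, E).prod 𝓘(ℝ, E)) ∞
        (fun p ↦ (⟨p, ofCoords x₀ p u⟩ : TangentBundle 𝓘(ℝ, E) M)) (chartAt E x₀).source := by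
      rw [Trivialization.contMDiffOn_section_iff (trivializationAt E (TangentSpace 𝓘(ℝ, E)) x₀)
        (chartAt E x₀).open_source subset_rfl]
      refine (contMDiffOn_const (c := u)).congr fun p hp ↦ ?_
      have h := coords_ofCoords hp u
      rw [coords, Trivialization.continuousLinearMapAt_apply,
        Trivialization.linearMapAt_apply, if_pos (show p ∈ (trivializationAt E (TangentSpace 𝓘(ℝ, E)) x₀).baseSet from hp)] at h
      exact h
    exact h1.comp (contMDiffOn_extChartAt_symm x₀) (fun y hy ↦ by
      simpa using (extChartAt 𝓘(ℝ, E) x₀).map_target hy)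
  exact ContMDiffOn.inner_bundle (E := fun x : M ↦ TangentSpace 𝓘(ℝ, E) x)
    (IB := 𝓘(ℝ, E)) (b := fun y ↦ (extChartAt 𝓘(ℝ, E) x₀).symm y) (key u) (key w)

lemma contDiffOn_metricForm [FiniteDimensional ℝ E] (x₀ : M) :
    ContDiffOn ℝ ∞ (fun y : E ↦ metricForm x₀ y) (extChartAt 𝓘(ℝ, E) x₀).target :=
  contDiffOn_clm_apply.2 fun u ↦ contDiffOn_clm_apply.2 fun w ↦ contDiffOn_metricInChart x₀ u w

end Metric

/-! ### Parallel fields: metric compatibility, uniqueness, independence of the chart -/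

section Parallel

variable {E : Type*} [NormedAddCommGroup E] [NormedSpace ℝ E]

/-- The Christoffel form `Γ(a, u, w) = ½ (B(a, u, w) + B(u, a, w) - B(w, a, u))` of a derivative
`B` of a metric tensor. -/
def christoffelForm (B : E →L[ℝ] E →L[ℝ] E →L[ℝ] ℝ) (a : E) : E →L[ℝ] E →L[ℝ] ℝ :=
  (1 / 2 : ℝ) • (B a + B.flip a - (B.flip a).flip)

lemma christoffelForm_apply (B : E →L[ℝ] E →L[ℝ] E →L[ℝ] ℝ) (a u w : E) :
    christoffelForm B a u w = (B a u w + B u a w - B w a u) / 2 := by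
  simp [christoffelForm]
  ring

lemma hasDerivWithinAt_clm_comp_apply {F : Type*} [NormedAddCommGroup F] [NormedSpace ℝ F]
    {T : E → E →L[ℝ] F} {T' : E →L[ℝ] E →L[ℝ] F} {c a : ℝ → E} {c' a' : E} {S : Set ℝ} {t : ℝ}
    (hT : HasFDerivAt T T' (c t)) (hc : HasDerivWithinAt c c' S t)
    (ha : HasDerivWithinAt a a' S t) :
    HasDerivWithinAt (fun s ↦ T (c s) (a s)) (T' c' (a t) + T (c t) a') S t := by
  have h1 : HasDerivWithinAt (fun s ↦ T (c s)) (T' c') S t := hT.comp_hasDerivWithinAt t hc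
  exact h1.clm_apply ha

lemma hasDerivWithinAt_bilin_comp_apply {G : E → E →L[ℝ] E →L[ℝ] ℝ}
    {B : E →L[ℝ] E →L[ℝ] E →L[ℝ] ℝ} {c a b : ℝ → E} {c' a' b' : E} {S : Set ℝ} {t : ℝ}
    (hG : HasFDerivAt G B (c t)) (hc : HasDerivWithinAt c c' S t)
    (ha : HasDerivWithinAt a a' S t) (hb : HasDerivWithinAt b b' S t) :
    HasDerivWithinAt (fun s ↦ G (c s) (a s) (b s))
      (B c' (a t) (b t) + G (c t) a' (b t) + G (c t) (a t) b') S t := by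
  have h := (hasDerivWithinAt_clm_comp_apply hG hc ha).clm_apply hb
  rwa [_root_.add_apply] at h

lemma hasFDerivAt_bilin_apply {G : E → E →L[ℝ] E →L[ℝ] ℝ} {B : E →L[ℝ] E →L[ℝ] E →L[ℝ] ℝ}
    {y : E} (hG : HasFDerivAt G B y) (u w : E) :
    HasFDerivAt (fun y ↦ G y u w) ((B.flip u).flip w) y := by
  have h := (hG.clm_apply (hasFDerivAt_const u y)).clm_apply (hasFDerivAt_const w y)
  refine h.congr_fderiv ?_
  ext a
  simp

variable [FiniteDimensional ℝ E]
  {M : Type*} [TopologicalSpace M] [ChartedSpace E M] [IsManifold 𝓘(ℝ, E) ∞ M]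
  [RiemannianBundle (fun x : M ↦ TangentSpace 𝓘(ℝ, E) x)]
  [IsContMDiffRiemannianBundle 𝓘(ℝ, E) ∞ E (fun x : M ↦ TangentSpace 𝓘(ℝ, E) x)]

lemma contDiffAt_metricForm {x₀ p : M} (hp : p ∈ (chartAt E x₀).source) :
    ContDiffAt ℝ ∞ (fun y : E ↦ metricForm x₀ y) (extChartAt 𝓘(ℝ, E) x₀ p) :=
  (contDiffOn_metricForm x₀).contDiffAt ((isOpen_extChartAt_target x₀).mem_nhds
    ((extChartAt 𝓘(ℝ, E) x₀).map_source (by simpa using hp)))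

/-- The derivative of the metric tensor in the chart at `x₀`. -/
def metricFormDeriv (x₀ : M) (y : E) : E →L[ℝ] E →L[ℝ] E →L[ℝ] ℝ :=
  fderiv ℝ (fun y : E ↦ metricForm x₀ y) y

lemma hasFDerivAt_metricForm {x₀ p : M} (hp : p ∈ (chartAt E x₀).source) :
    HasFDerivAt (fun y : E ↦ metricForm x₀ y)
      (metricFormDeriv x₀ (extChartAt 𝓘(ℝ, E) x₀ p)) (extChartAt 𝓘(ℝ, E) x₀ p) :=
  ((contDiffAt_metricForm hp).differentiableAt (by simp)).hasFDerivAt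

lemma hasFDerivAt_metricForm_apply {x₀ p : M} (hp : p ∈ (chartAt E x₀).source) (u w : E) :
    HasFDerivAt (fun y : E ↦ metricForm x₀ y u w)
      (((metricFormDeriv x₀ (extChartAt 𝓘(ℝ, E) x₀ p)).flip u).flip w)
      (extChartAt 𝓘(ℝ, E) x₀ p) :=
  hasFDerivAt_bilin_apply (hasFDerivAt_metricForm hp) u w

lemma christoffelFirst_eq (x₀ : M) (u v w : E) :
    christoffelFirst x₀ u v w
      = christoffelForm (metricFormDeriv x₀ (extChartAt 𝓘(ℝ, E) x₀ x₀)) u v w := by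
  have key : ∀ a u w : E, metricDeriv x₀ a u w
      = metricFormDeriv x₀ (extChartAt 𝓘(ℝ, E) x₀ x₀) a u w := by
    intro a u w
    have h : metricDeriv x₀ a u w = fderiv ℝ (fun y : E ↦ metricForm x₀ y u w)
      (extChartAt 𝓘(ℝ, E) x₀ x₀) a := rfl
    rw [h, (hasFDerivAt_metricForm_apply (mem_chart_source E x₀) u w).fderiv]
    rfl
  rw [christoffelFirst, christoffelForm_apply, key, key, key]

lemma metricForm_symm (x₀ : M) (y u w : E) : metricForm x₀ y u w = metricForm x₀ y w u :=
  metricInChart_symm x₀ y u w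

lemma metricFormDeriv_symm {x₀ p : M} (hp : p ∈ (chartAt E x₀).source) (a u w : E) :
    metricFormDeriv x₀ (extChartAt 𝓘(ℝ, E) x₀ p) a u w
      = metricFormDeriv x₀ (extChartAt 𝓘(ℝ, E) x₀ p) a w u := by
  have h1 := hasFDerivAt_metricForm_apply hp u w
  have h2 := hasFDerivAt_metricForm_apply hp w u
  have h3 : (fun y : E ↦ metricForm x₀ y u w) = fun y ↦ metricForm x₀ y w u :=
    funext fun y ↦ metricForm_symm x₀ y u w
  rw [h3] at h1
  have := congrArg (fun D : E →L[ℝ] ℝ ↦ D a) (h1.unique h2)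
  exact this

lemma eventually_mem_chart_source {γ : ℝ → M} {t : ℝ} {x₀ : M} (hγ : ContinuousAt γ t)
    (h₀ : γ t ∈ (chartAt E x₀).source) : ∀ᶠ s in nhds t, γ s ∈ (chartAt E x₀).source :=
  hγ.eventually_mem ((chartAt E x₀).open_source.mem_nhds h₀)

lemma hasDerivWithinAt_inner {γ : ℝ → M} {V W : ∀ t, TangentSpace 𝓘(ℝ, E) (γ t)} {S : Set ℝ}
    {t : ℝ} (hγ : MDifferentiableAt 𝓘(ℝ, ℝ) 𝓘(ℝ, E) γ t) (ht : t ∈ S) {v' w' : E}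
    (hV : HasDerivWithinAt (fun s ↦ coords (γ t) (γ s) (V s)) v' S t)
    (hW : HasDerivWithinAt (fun s ↦ coords (γ t) (γ s) (W s)) w' S t) :
    HasDerivWithinAt (fun s ↦ inner ℝ (V s) (W s))
      (metricFormDeriv (γ t) (extChartAt 𝓘(ℝ, E) (γ t) (γ t))
          (coords (γ t) (γ t) (velocity γ t)) (coords (γ t) (γ t) (V t)) (coords (γ t) (γ t) (W t))
        + metricForm (γ t) (extChartAt 𝓘(ℝ, E) (γ t) (γ t)) v' (coords (γ t) (γ t) (W t))
        + metricForm (γ t) (extChartAt 𝓘(ℝ, E) (γ t) (γ t)) (coords (γ t) (γ t) (V t)) w') S t := by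
  have h0 := mem_chart_source E (γ t)
  have hc := (coords_velocity hγ h0).hasDerivWithinAt (s := S)
  have h := hasDerivWithinAt_bilin_comp_apply (c := fun s ↦ extChartAt 𝓘(ℝ, E) (γ t) (γ s))
    (hasFDerivAt_metricForm h0) hc hV hW
  have hev : (fun s : ℝ ↦ inner ℝ (V s) (W s)) =ᶠ[nhdsWithin t S] fun s : ℝ ↦
      metricForm (γ t) (extChartAt 𝓘(ℝ, E) (γ t) (γ s))
        (coords (γ t) (γ s) (V s)) (coords (γ t) (γ s) (W s)) := by
    filter_upwards [nhdsWithin_le_nhds (eventually_mem_chart_source hγ.continuousAt h0)] with s hs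
    exact inner_eq_metricForm hs (V s) (W s)
  exact h.congr_of_eventuallyEq_of_mem hev ht

/-- Metric compatibility of the Levi-Civita connection: Γ(a, V, W) + Γ(a, W, V) is the derivative of
the metric in direction a, because the other terms cancel by symmetry of the metric. -/
lemma IsParallelOn.hasDerivWithinAt_inner {γ : ℝ → M}
    {V W : ∀ t, TangentSpace 𝓘(ℝ, E) (γ t)} {S : Set ℝ}
    (hγ : MDifferentiable 𝓘(ℝ, ℝ) 𝓘(ℝ, E) γ)
    (hV : IsParallelOn γ V S) (hW : IsParallelOn γ W S) {t : ℝ} (ht : t ∈ S) :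
    HasDerivWithinAt (fun s ↦ inner ℝ (V s) (W s)) 0 S t := by
  obtain ⟨v', hv', hv⟩ := hV t ht
  obtain ⟨w', hw', hw⟩ := hW t ht
  convert RPAGE.hasDerivWithinAt_inner (hγ t) ht hv' hw' using 1
  have h1 := hv (coords (γ t) (γ t) (W t))
  have h2 := hw (coords (γ t) (γ t) (V t))
  rw [← metricForm_apply, christoffelFirst_eq, christoffelForm_apply] at h1 h2
  have h0 := mem_chart_source E (γ t)
  rw [metricForm_symm _ _ w'] at h2
  rw [metricFormDeriv_symm h0 _ (coords (γ t) (γ t) (W t)) (coords (γ t) (γ t) (V t))] at h2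
  linarith

lemma IsParallelOn.inner_eq {γ : ℝ → M} {V W : ∀ t, TangentSpace 𝓘(ℝ, E) (γ t)} {S : Set ℝ}
    (hγ : MDifferentiable 𝓘(ℝ, ℝ) 𝓘(ℝ, E) γ) (hS : Convex ℝ S)
    (hV : IsParallelOn γ V S) (hW : IsParallelOn γ W S) {s t : ℝ} (hs : s ∈ S) (ht : t ∈ S) :
    inner ℝ (V s) (W s) = inner ℝ (V t) (W t) := by
  have h := hS.norm_image_sub_le_of_norm_hasDerivWithin_le (C := 0)
    (f := fun s ↦ inner ℝ (V s) (W s)) (f' := fun _ ↦ 0)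
    (fun x hx ↦ hV.hasDerivWithinAt_inner hγ hW hx) (by simp) hs ht
  rw [zero_mul, norm_le_zero_iff, sub_eq_zero] at h
  exact h.symm

lemma IsParallelOn.add {γ : ℝ → M} {V W : ∀ t, TangentSpace 𝓘(ℝ, E) (γ t)} {S : Set ℝ}
    (hV : IsParallelOn γ V S) (hW : IsParallelOn γ W S) :
    IsParallelOn γ (fun t ↦ V t + W t) S := by
  intro t ht
  obtain ⟨v', hv', hv⟩ := hV t ht
  obtain ⟨w', hw', hw⟩ := hW t ht
  refine ⟨v' + w', (hv'.add hw').congr_of_eventuallyEq_of_mem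
    (.of_forall fun s ↦ coords_add _ _ _ _) ht, fun w ↦ ?_⟩
  have h1 := hv w
  have h2 := hw w
  rw [← metricForm_apply, christoffelFirst_eq] at *
  simp only [coords_add, map_add, _root_.add_apply]
  linarith

lemma IsParallelOn.smul {γ : ℝ → M} {V : ∀ t, TangentSpace 𝓘(ℝ, E) (γ t)} {S : Set ℝ}
    (hV : IsParallelOn γ V S) (c : ℝ) : IsParallelOn γ (fun t ↦ c • V t) S := by
  intro t ht
  obtain ⟨v', hv', hv⟩ := hV t ht
  refine ⟨c • v', (hv'.const_smul c).congr_of_eventuallyEq_of_mem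
    (.of_forall fun s ↦ coords_smul _ _ _ _) ht, fun w ↦ ?_⟩
  have h1 := hv w
  rw [← metricForm_apply, christoffelFirst_eq] at *
  simp only [coords_smul, map_smul, _root_.smul_apply, smul_eq_mul]
  linear_combination c * h1

lemma IsParallelOn.mono {γ : ℝ → M} {V : ∀ t, TangentSpace 𝓘(ℝ, E) (γ t)} {S T : Set ℝ}
    (hV : IsParallelOn γ V S) (h : T ⊆ S) : IsParallelOn γ V T := by
  intro t ht
  obtain ⟨v', hv', hv⟩ := hV t (h ht)
  exact ⟨v', hv'.mono h, hv⟩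

/-- The difference of the two fields is parallel, so its norm is constant. This gives uniqueness
without a theorem on differential equations. -/
lemma IsParallelOn.eq_of_eq {γ : ℝ → M} {V W : ∀ t, TangentSpace 𝓘(ℝ, E) (γ t)} {S : Set ℝ}
    (hγ : MDifferentiable 𝓘(ℝ, ℝ) 𝓘(ℝ, E) γ) (hS : Convex ℝ S)
    (hV : IsParallelOn γ V S) (hW : IsParallelOn γ W S) {s t : ℝ} (hs : s ∈ S) (ht : t ∈ S)
    (h : V s = W s) : V t = W t := by
  have hD := hV.add (hW.smul (-1))
  have h1 := hD.inner_eq hγ hS hD ht hs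
  simp only [h, neg_smul, one_smul, add_neg_cancel, inner_zero_left, inner_self_eq_zero] at h1
  exact add_neg_eq_zero.1 h1

/-- The transformation law of the derivative of the metric tensor under a change of charts. -/
lemma metricFormDeriv_transition {x₀ x₁ p : M} (h₀ : p ∈ (chartAt E x₀).source)
    (h₁ : p ∈ (chartAt E x₁).source) (a u w : E) :
    metricFormDeriv x₀ (extChartAt 𝓘(ℝ, E) x₀ p) a u w
      = metricFormDeriv x₁ (extChartAt 𝓘(ℝ, E) x₁ p)
          (fderiv ℝ (transition x₀ x₁) (extChartAt 𝓘(ℝ, E) x₀ p) a)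
          (fderiv ℝ (transition x₀ x₁) (extChartAt 𝓘(ℝ, E) x₀ p) u)
          (fderiv ℝ (transition x₀ x₁) (extChartAt 𝓘(ℝ, E) x₀ p) w)
        + metricForm x₁ (extChartAt 𝓘(ℝ, E) x₁ p)
          (fderiv ℝ (fderiv ℝ (transition x₀ x₁)) (extChartAt 𝓘(ℝ, E) x₀ p) a u)
          (fderiv ℝ (transition x₀ x₁) (extChartAt 𝓘(ℝ, E) x₀ p) w)
        + metricForm x₁ (extChartAt 𝓘(ℝ, E) x₁ p)
          (fderiv ℝ (transition x₀ x₁) (extChartAt 𝓘(ℝ, E) x₀ p) u)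
          (fderiv ℝ (fderiv ℝ (transition x₀ x₁)) (extChartAt 𝓘(ℝ, E) x₀ p) a w) := by
  set y := extChartAt 𝓘(ℝ, E) x₀ p with hy
  have hτ := contDiffAt_transition h₀ h₁
  rw [← hy] at hτ
  have hτ1 : HasFDerivAt (transition x₀ x₁) (fderiv ℝ (transition x₀ x₁) y) y :=
    (hτ.differentiableAt (by simp)).hasFDerivAt
  have hτ2 : HasFDerivAt (fderiv ℝ (transition x₀ x₁)) (fderiv ℝ (fderiv ℝ (transition x₀ x₁)) y) y :=
    ((hτ.fderiv_right (m := 1) (by norm_cast)).differentiableAt (by simp)).hasFDerivAt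
  have hG := hasFDerivAt_metricForm h₁
  rw [← transition_extChartAt x₁ h₀, ← hy] at hG
  have hcomp := ((hG.comp y hτ1).clm_apply (hτ2.clm_apply (hasFDerivAt_const u y))).clm_apply
    (hτ2.clm_apply (hasFDerivAt_const w y))
  have hG0 := hasFDerivAt_metricForm_apply h₀ u w
  rw [← hy] at hG0
  -- Near `y` the metric in the first chart is the pullback of the metric in the second by the
  -- transition map; the product rule applied to this identity gives the three terms.
  have hev : (fun z : E ↦ metricForm x₀ z u w) =ᶠ[nhds y] fun z ↦
      metricForm x₁ (transition x₀ x₁ z) (fderiv ℝ (transition x₀ x₁) z u)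
        (fderiv ℝ (transition x₀ x₁) z w) := by
    have hsymm := continuousAt_extChartAt_symm'' (I := 𝓘(ℝ, E)) (x := x₀) (y := y)
      ((extChartAt 𝓘(ℝ, E) x₀).map_source (by simpa using h₀))
    have hyp : (extChartAt 𝓘(ℝ, E) x₀).symm y = p :=
      (extChartAt 𝓘(ℝ, E) x₀).left_inv (by simpa using h₀)
    have e1 := hsymm.eventually_mem ((chartAt E x₁).open_source.mem_nhds (hyp ▸ h₁))
    filter_upwards [e1, (isOpen_extChartAt_target x₀).mem_nhds
      ((extChartAt 𝓘(ℝ, E) x₀).map_source (by simpa using h₀))] with z hz1 hz0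
    set q := (extChartAt 𝓘(ℝ, E) x₀).symm z with hq
    have hq0 : q ∈ (chartAt E x₀).source := by
      simpa only [extChartAt_source] using (extChartAt 𝓘(ℝ, E) x₀).map_target hz0
    have hzq : z = extChartAt 𝓘(ℝ, E) x₀ q := ((extChartAt 𝓘(ℝ, E) x₀).right_inv hz0).symm
    have hu := coords_eq_fderiv_transition hq0 hz1 (ofCoords x₀ q u)
    have hw := coords_eq_fderiv_transition hq0 hz1 (ofCoords x₀ q w)
    rw [coords_ofCoords hq0] at hu hw
    rw [hzq, ← hu, ← hw, transition_extChartAt x₁ hq0, ← inner_eq_metricForm hz1,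
      inner_eq_metricForm hq0, coords_ofCoords hq0, coords_ofCoords hq0]
  have := congrArg (fun D : E →L[ℝ] ℝ ↦ D a) (hG0.unique (hcomp.congr_of_eventuallyEq hev))
  rw [← transition_extChartAt x₁ h₀, ← hy]
  simp at this
  linarith

/-- The transformation law of the Christoffel symbols of the first kind. -/
lemma christoffelForm_transition {x₀ x₁ p : M} (h₀ : p ∈ (chartAt E x₀).source)
    (h₁ : p ∈ (chartAt E x₁).source) (a u w : E) :
    christoffelForm (metricFormDeriv x₀ (extChartAt 𝓘(ℝ, E) x₀ p)) a u w
      = christoffelForm (metricFormDeriv x₁ (extChartAt 𝓘(ℝ, E) x₁ p))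
          (fderiv ℝ (transition x₀ x₁) (extChartAt 𝓘(ℝ, E) x₀ p) a)
          (fderiv ℝ (transition x₀ x₁) (extChartAt 𝓘(ℝ, E) x₀ p) u)
          (fderiv ℝ (transition x₀ x₁) (extChartAt 𝓘(ℝ, E) x₀ p) w)
        + metricForm x₁ (extChartAt 𝓘(ℝ, E) x₁ p)
          (fderiv ℝ (fderiv ℝ (transition x₀ x₁)) (extChartAt 𝓘(ℝ, E) x₀ p) a u)
          (fderiv ℝ (transition x₀ x₁) (extChartAt 𝓘(ℝ, E) x₀ p) w) := by
  -- The three metric derivatives bring six Hessian terms. Symmetry of the second derivative cancels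
  -- four of them and makes the other two equal, which the factor ½ turns into one.
  have hs := (contDiffAt_transition h₀ h₁).isSymmSndFDerivAt (by
    rw [minSmoothness_of_isRCLikeNormedField]; norm_cast)
  simp only [christoffelForm_apply, metricFormDeriv_transition h₀ h₁]
  rw [hs.eq u a, hs.eq w a, hs.eq w u,
    metricForm_symm x₁ _ (fderiv ℝ (transition x₀ x₁) (extChartAt 𝓘(ℝ, E) x₀ p) a),
    metricForm_symm x₁ _ _ (fderiv ℝ (transition x₀ x₁) (extChartAt 𝓘(ℝ, E) x₀ p) u)]
  ring

/-- A solution of the parallel transport equation in one chart is a parallel vector field. -/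
lemma isParallelOn_of_chart {γ : ℝ → M} (hγ : MDifferentiable 𝓘(ℝ, ℝ) 𝓘(ℝ, E) γ) {x₀ : M}
    {S : Set ℝ} (hS : ∀ t ∈ S, γ t ∈ (chartAt E x₀).source) {U U' : ℝ → E}
    (hU : ∀ t ∈ S, HasDerivWithinAt U (U' t) S t)
    (heq : ∀ t ∈ S, ∀ w, metricForm x₀ (extChartAt 𝓘(ℝ, E) x₀ (γ t)) (U' t) w
      + christoffelForm (metricFormDeriv x₀ (extChartAt 𝓘(ℝ, E) x₀ (γ t)))
        (coords x₀ (γ t) (velocity γ t)) (U t) w = 0) :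
    IsParallelOn γ (fun t ↦ ofCoords x₀ (γ t) (U t)) S := by
  intro t ht
  have h₀ := hS t ht
  have h₁ := mem_chart_source E (γ t)
  set τ : E → E := transition x₀ (γ t) with hτdef
  set y := extChartAt 𝓘(ℝ, E) x₀ (γ t) with hy
  have hτ : ContDiffAt ℝ ∞ τ y := contDiffAt_transition h₀ h₁
  have hτ2 : HasFDerivAt (fderiv ℝ τ) (fderiv ℝ (fderiv ℝ τ) y) y :=
    ((hτ.fderiv_right (m := 1) (by norm_cast)).differentiableAt (by simp)).hasFDerivAt
  have hc := (coords_velocity (hγ t) h₀).hasDerivWithinAt (s := S)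
  have hd := hasDerivWithinAt_clm_comp_apply (c := fun s ↦ extChartAt 𝓘(ℝ, E) x₀ (γ s))
    hτ2 hc (hU t ht)
  -- With τ the transition map and c the curve in the chart, the derivative supplied is D²τ(c′, U) +
  -- Dτ(U′). Its Hessian term is the inhomogeneous term in `christoffelForm_transition`.
  refine ⟨_, hd.congr_of_eventuallyEq_of_mem ?_ ht, fun w ↦ ?_⟩
  · filter_upwards [nhdsWithin_le_nhds (eventually_mem_chart_source (hγ t).continuousAt h₁),
      nhdsWithin_le_nhds (eventually_mem_chart_source (hγ t).continuousAt h₀)] with s hs1 hs0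
    rw [coords_eq_fderiv_transition hs0 hs1, coords_ofCoords hs0]
  · have hw := coords_eq_fderiv_transition h₀ h₁ (ofCoords (γ t) (γ t) w)
    rw [coords_ofCoords h₁] at hw
    set w₀ := coords x₀ (γ t) (ofCoords (γ t) (γ t) w)
    have hV := coords_eq_fderiv_transition h₀ h₁ (ofCoords x₀ (γ t) (U t))
    rw [coords_ofCoords h₀] at hV
    have hvel := coords_eq_fderiv_transition h₀ h₁ (velocity γ t)
    have hu' := coords_eq_fderiv_transition h₀ h₁ (ofCoords x₀ (γ t) (U' t))
    rw [coords_ofCoords h₀] at hu'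
    have e := heq t ht w₀
    rw [christoffelForm_transition h₀ h₁, ← hvel, ← hV, ← hw] at e
    have e2 : metricForm x₀ y (U' t) w₀
        = metricForm (γ t) (extChartAt 𝓘(ℝ, E) (γ t) (γ t)) (fderiv ℝ τ y (U' t)) w := by
      have := inner_eq_metricForm h₁ (ofCoords x₀ (γ t) (U' t)) (ofCoords (γ t) (γ t) w)
      rw [inner_eq_metricForm h₀, coords_ofCoords h₀, hu', coords_ofCoords h₁] at this
      exact this
    rw [e2] at e
    rw [← metricForm_apply, christoffelFirst_eq, map_add, _root_.add_apply]
    linarith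

end Parallel

/-! ### Existence of parallel fields and isometry of parallel transport -/

section Existence

/-- A linear differential equation has solutions on short intervals, with prescribed value at any
time. -/
lemma exists_linear_ode_solution {E : Type*} [NormedAddCommGroup E] [NormedSpace ℝ E]
    [CompleteSpace E] {A : ℝ → E →L[ℝ] E} {a b C s : ℝ} (hA : ContinuousOn A (Set.Icc a b))
    (hC : 0 ≤ C) (hAC : ∀ t ∈ Set.Icc a b, ‖A t‖ ≤ C) (hab : 2 * C * (b - a) ≤ 1)
    (hs : s ∈ Set.Icc a b) (u : E) :
    ∃ U : ℝ → E, U s = u ∧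
      ∀ t ∈ Set.Icc a b, HasDerivWithinAt U (A t (U t)) (Set.Icc a b) t := by
  lift C to NNReal using hC
  -- On the ball of radius ‖u‖ about `u` one has ‖x‖ ≤ 2‖u‖, so the speed is at most 2C‖u‖, and the
  -- length condition keeps the solution in the ball.
  have hP : IsPicardLindelof (fun t x ↦ A t x) (⟨s, hs⟩ : Set.Icc a b) u ‖u‖₊ 0
      (C * (2 * ‖u‖₊)) C := by
    refine ⟨fun t ht ↦ ?_, fun x _ ↦ ?_, fun t ht x hx ↦ ?_, ?_⟩
    · exact ((A t).lipschitz.weaken (by exact_mod_cast hAC t ht)).lipschitzOnWith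
    · exact hA.clm_apply continuousOn_const
    · refine ((A t).le_of_opNorm_le (hAC t ht) x).trans ?_
      push_cast
      have h1 : ‖x - u‖ ≤ ‖u‖ := by simpa [dist_eq_norm] using hx
      have h2 : ‖x‖ ≤ 2 * ‖u‖ := by
        have := norm_le_norm_sub_add x u
        linarith
      gcongr
    · push_cast
      have h1 : max (b - s) (s - a) ≤ b - a := max_le (by linarith [hs.1]) (by linarith [hs.2])
      have h2 : 2 * (C : ℝ) * max (b - s) (s - a) ≤ 1 :=
        (mul_le_mul_of_nonneg_left h1 (by positivity)).trans hab
      have := mul_le_mul_of_nonneg_right h2 (norm_nonneg u)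
      simp only [sub_zero]
      linarith
  obtain ⟨U, h1, h2⟩ := hP.exists_eq_forall_mem_Icc_hasDerivWithinAt₀
  exact ⟨U, h1, h2⟩

variable {E : Type*} [NormedAddCommGroup E] [NormedSpace ℝ E] [FiniteDimensional ℝ E]
  {M : Type*} [TopologicalSpace M] [ChartedSpace E M] [IsManifold 𝓘(ℝ, E) ∞ M]
  [RiemannianBundle (fun x : M ↦ TangentSpace 𝓘(ℝ, E) x)]
  [IsContMDiffRiemannianBundle 𝓘(ℝ, E) ∞ E (fun x : M ↦ TangentSpace 𝓘(ℝ, E) x)]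

lemma metricForm_injective {x₀ p : M} (hp : p ∈ (chartAt E x₀).source) :
    Function.Injective (metricForm x₀ (extChartAt 𝓘(ℝ, E) x₀ p)) := by
  rw [injective_iff_map_eq_zero]
  intro u hu
  by_contra h
  have := metricForm_pos hp h
  rw [hu] at this
  exact lt_irrefl _ this

/-- A definite form is nondegenerate, which suffices in finite dimension. It allows the lowered
index in the transport equation to be raised. -/
lemma exists_metricForm_equiv {x₀ p : M} (hp : p ∈ (chartAt E x₀).source) :
    ∃ e : E ≃L[ℝ] (E →L[ℝ] ℝ),
      (e : E →L[ℝ] E →L[ℝ] ℝ) = metricForm x₀ (extChartAt 𝓘(ℝ, E) x₀ p) := by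
  have hfin : Module.finrank ℝ E = Module.finrank ℝ (E →L[ℝ] ℝ) := by
    rw [← (LinearMap.toContinuousLinearMap (𝕜 := ℝ) (E := E) (F' := ℝ)).finrank_eq]
    exact (Subspace.dual_finrank_eq).symm
  let e := LinearEquiv.ofInjectiveOfFinrankEq
    (metricForm x₀ (extChartAt 𝓘(ℝ, E) x₀ p) : E →ₗ[ℝ] E →L[ℝ] ℝ) (metricForm_injective hp) hfin
  refine ⟨e.toContinuousLinearEquiv, ?_⟩
  ext u w
  rfl

/-- The operator of the parallel transport equation along `γ` in the chart at `x₀`. -/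
def transportOperator (γ : ℝ → M) (x₀ : M) (t : ℝ) : E →L[ℝ] E :=
  -((metricForm x₀ (extChartAt 𝓘(ℝ, E) x₀ (γ t))).inverse ∘L
    christoffelForm (metricFormDeriv x₀ (extChartAt 𝓘(ℝ, E) x₀ (γ t)))
      (coords x₀ (γ t) (velocity γ t)))

lemma transportOperator_spec {γ : ℝ → M} {x₀ : M} {t : ℝ} (ht : γ t ∈ (chartAt E x₀).source)
    (u w : E) :
    metricForm x₀ (extChartAt 𝓘(ℝ, E) x₀ (γ t)) (transportOperator γ x₀ t u) w
      + christoffelForm (metricFormDeriv x₀ (extChartAt 𝓘(ℝ, E) x₀ (γ t)))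
        (coords x₀ (γ t) (velocity γ t)) u w = 0 := by
  obtain ⟨e, he⟩ := exists_metricForm_equiv ht
  rw [transportOperator, ← he, ContinuousLinearMap.inverse_equiv]
  simp

lemma continuousAt_transportOperator {γ : ℝ → M} (hγ : ContMDiff 𝓘(ℝ, ℝ) 𝓘(ℝ, E) ∞ γ) {x₀ : M}
    {t : ℝ} (ht : γ t ∈ (chartAt E x₀).source) : ContinuousAt (transportOperator (E := E) γ x₀) t := by
  have hc : ContDiffAt ℝ ∞ (fun s ↦ extChartAt 𝓘(ℝ, E) x₀ (γ s)) t :=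
    ((contMDiffAt_extChartAt' ht).comp t hγ.contMDiffAt).contDiffAt
  have hv : ContinuousAt (fun s ↦ coords (E := E) x₀ (γ s) (velocity γ s)) t := by
    have h1 : ContinuousAt (deriv fun s ↦ extChartAt 𝓘(ℝ, E) x₀ (γ s)) t :=
      (hc.fderiv_right (m := 0) (by norm_cast)).continuousAt.clm_apply continuousAt_const
    refine h1.congr ?_
    filter_upwards [eventually_mem_chart_source hγ.continuous.continuousAt ht] with s hs
    exact (coords_velocity (hγ.mdifferentiable (by simp) s) hs).deriv
  have hG := (contDiffAt_metricForm ht)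
  have h1 : ContinuousAt (fun s ↦ metricForm x₀ (extChartAt 𝓘(ℝ, E) x₀ (γ s))) t :=
    hG.continuousAt.comp (f := fun s ↦ extChartAt 𝓘(ℝ, E) x₀ (γ s)) hc.continuousAt
  have h2 : ContinuousAt (fun s ↦ metricFormDeriv x₀ (extChartAt 𝓘(ℝ, E) x₀ (γ s))) t :=
    (hG.fderiv_right (m := 0) (by norm_cast)).continuousAt.comp
      (f := fun s ↦ extChartAt 𝓘(ℝ, E) x₀ (γ s)) hc.continuousAt
  obtain ⟨e, he⟩ := exists_metricForm_equiv ht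
  have h3 : ContinuousAt (fun s ↦ (metricForm x₀ (extChartAt 𝓘(ℝ, E) x₀ (γ s))).inverse) t := by
    have h := (contDiffAt_map_inverse (n := 0) e).continuousAt
    rw [he] at h
    exact h.comp (f := fun s ↦ metricForm x₀ (extChartAt 𝓘(ℝ, E) x₀ (γ s))) h1
  have h4 : ContinuousAt (fun s ↦ christoffelForm
      (metricFormDeriv x₀ (extChartAt 𝓘(ℝ, E) x₀ (γ s))) (coords x₀ (γ s) (velocity γ s))) t := by
    have hflip : ContinuousAt
        (fun s ↦ (metricFormDeriv x₀ (extChartAt 𝓘(ℝ, E) x₀ (γ s))).flip) t :=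
      (ContinuousLinearMap.flipₗᵢ ℝ E E (E →L[ℝ] ℝ)).continuous.continuousAt.comp h2
    have hflip2 := hflip.clm_apply hv
    have hflip3 : ContinuousAt (fun s ↦ ((metricFormDeriv x₀ (extChartAt 𝓘(ℝ, E) x₀ (γ s))).flip
        (coords x₀ (γ s) (velocity γ s))).flip) t :=
      (ContinuousLinearMap.flipₗᵢ ℝ E E ℝ).continuous.continuousAt.comp hflip2
    exact ((h2.clm_apply hv).add hflip2 |>.sub hflip3).const_smul (1 / 2 : ℝ)
  exact (h3.clm_comp h4).neg

/-- Parallel fields along `γ` over `[a, b]` exist, with prescribed value at any time. -/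
def HasParallelFields (γ : ℝ → M) (a b : ℝ) : Prop :=
  ∀ s ∈ Set.Icc a b, ∀ u : TangentSpace 𝓘(ℝ, E) (γ s), ∃ V : ∀ t, TangentSpace 𝓘(ℝ, E) (γ t),
    IsParallelOn γ V (Set.Icc a b) ∧ V s = u

lemma eventually_hasParallelFields {γ : ℝ → M} (hγ : ContMDiff 𝓘(ℝ, ℝ) 𝓘(ℝ, E) ∞ γ) (t₀ : ℝ) :
    ∃ δ > 0, ∀ a b, Set.Icc a b ⊆ Set.Ioo (t₀ - δ) (t₀ + δ) →
      HasParallelFields (E := E) γ a b := by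
  set x₀ := γ t₀ with hx₀
  have h0 := mem_chart_source E (γ t₀)
  have e1 := eventually_mem_chart_source hγ.continuous.continuousAt h0
  have e2 := ((continuousAt_transportOperator hγ h0).norm).eventually_lt_const
    (lt_add_one ‖transportOperator (E := E) γ x₀ t₀‖)
  obtain ⟨δ, hδ, hball⟩ := Metric.eventually_nhds_iff.1 (e1.and e2)
  set C := ‖transportOperator (E := E) γ x₀ t₀‖ + 1
  have hC : 0 < C := by positivity
  -- The interval is shorter than twice this radius, hence than 1/(2C), as the short-time existence
  -- result requires.
  refine ⟨min δ (1 / (4 * C)), by positivity, fun a b hab s hs u ↦ ?_⟩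
  have hle : a ≤ b := hs.1.trans hs.2
  have hmem : ∀ t ∈ Set.Icc a b, γ t ∈ (chartAt E x₀).source ∧
      ‖transportOperator (E := E) γ x₀ t‖ < C := by
    intro t ht
    obtain ⟨h1, h2⟩ := hab ht
    have := min_le_left δ (1 / (4 * C))
    exact hball (by rw [Real.dist_eq, abs_lt]; constructor <;> linarith)
  have hlen : 2 * C * (b - a) ≤ 1 := by
    have h1 := (hab (Set.left_mem_Icc.2 hle)).1
    have h2 := (hab (Set.right_mem_Icc.2 hle)).2
    have h3 := min_le_right δ (1 / (4 * C))
    have h4 : b - a ≤ 2 * (1 / (4 * C)) := by linarith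
    calc 2 * C * (b - a) ≤ 2 * C * (2 * (1 / (4 * C))) := by gcongr
      _ = 1 := by field_simp; norm_num
  obtain ⟨U, hU0, hU⟩ := exists_linear_ode_solution
    (fun t ht ↦ (continuousAt_transportOperator hγ (hmem t ht).1).continuousWithinAt) hC.le
    (fun t ht ↦ (hmem t ht).2.le) hlen hs (coords x₀ (γ s) u)
  refine ⟨fun t ↦ ofCoords x₀ (γ t) (U t), isParallelOn_of_chart (hγ.mdifferentiable (by simp))
    (fun t ht ↦ (hmem t ht).1) hU
    (fun t ht w ↦ transportOperator_spec (hmem t ht).1 _ w), ?_⟩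
  simp only [hU0]
  exact ofCoords_coords (hmem s hs).1 u

/-- At `c` the transport equation determines the derivative from the value of the field, by
nondegeneracy of the metric. The two one-sided derivatives therefore agree. -/
lemma IsParallelOn.glue {γ : ℝ → M} {V W : ∀ t, TangentSpace 𝓘(ℝ, E) (γ t)} {a c b : ℝ}
    (hac : a ≤ c) (hcb : c ≤ b) (hV : IsParallelOn γ V (Set.Icc a c))
    (hW : IsParallelOn γ W (Set.Icc c b)) (hVW : V c = W c) :
    ∃ Z : ∀ t, TangentSpace 𝓘(ℝ, E) (γ t), IsParallelOn γ Z (Set.Icc a b) ∧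
      (∀ t ∈ Set.Icc a c, Z t = V t) ∧ ∀ t ∈ Set.Icc c b, Z t = W t := by
  classical
  set Z : ∀ t, TangentSpace 𝓘(ℝ, E) (γ t) := fun t ↦ if t ≤ c then V t else W t with hZ
  have hZV : ∀ t ∈ Set.Icc a c, Z t = V t := fun t ht ↦ if_pos ht.2
  have hZW : ∀ t ∈ Set.Icc c b, Z t = W t := by
    intro t ht
    rcases ht.1.eq_or_lt with rfl | h
    · rw [← hVW]
      exact if_pos le_rfl
    · exact if_neg (not_le.2 h)
  refine ⟨Z, fun t ht ↦ ?_, hZV, hZW⟩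
  rw [← Set.Icc_union_Icc_eq_Icc hac hcb]
  have key : ∀ (S : Set ℝ) (Y : ∀ t, TangentSpace 𝓘(ℝ, E) (γ t)), (∀ s ∈ S, Z s = Y s) →
      ∀ {v' : E}, t ∈ S → HasDerivWithinAt (fun s ↦ coords (γ t) (γ s) (Y s)) v' S t →
      HasDerivWithinAt (fun s ↦ coords (γ t) (γ s) (Z s)) v' S t :=
    fun S Y h v' htS hd ↦ hd.congr (fun s hs ↦ by rw [h s hs]) (by rw [h t htS])
  -- Away from a closed set, differentiability within it is vacuous; at `t ≠ c` only one of the two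
  -- intervals matters.
  have triv : ∀ (S : Set ℝ) (v' : E), IsClosed S → t ∉ S →
      HasDerivWithinAt (fun s ↦ coords (γ t) (γ s) (Z s)) v' S t :=
    fun S v' hS h ↦ HasFDerivWithinAt.of_notMem_closure (by rwa [hS.closure_eq])
  rcases lt_trichotomy t c with h | h | h
  · have htV : t ∈ Set.Icc a c := ⟨ht.1, h.le⟩
    obtain ⟨v', h1, h2⟩ := hV t htV
    rw [hZV t htV]
    exact ⟨v', (key _ V hZV htV h1).union (triv _ _ isClosed_Icc fun h' ↦ not_le.2 h h'.1), h2⟩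
  · subst h
    have htV : t ∈ Set.Icc a t := ⟨hac, le_rfl⟩
    have htW : t ∈ Set.Icc t b := ⟨le_rfl, hcb⟩
    obtain ⟨v', h1, h2⟩ := hV t htV
    obtain ⟨w', h3, h4⟩ := hW t htW
    have hvw : v' = w' := by
      apply metricForm_injective (mem_chart_source E (γ t))
      ext w
      have e1 := h2 w
      have e2 := h4 w
      rw [hVW] at e1
      rw [← metricForm_apply] at e1 e2
      linarith
    subst hvw
    rw [hZV t htV]
    exact ⟨v', (key _ V hZV htV h1).union (key _ W hZW htW h3), h2⟩
  · have htW : t ∈ Set.Icc c b := ⟨h.le, ht.2⟩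
    obtain ⟨v', h1, h2⟩ := hW t htW
    rw [hZW t htW]
    exact ⟨v', (triv _ _ isClosed_Icc fun h' ↦ not_le.2 h h'.2).union (key _ W hZW htW h1), h2⟩

/-- The prescribed time may lie in either half, so the field is extended forwards or backwards
across `c`. This is why `HasParallelFields` allows data at any time. -/
lemma HasParallelFields.trans {γ : ℝ → M} {a c b : ℝ} (hac : a ≤ c) (hcb : c ≤ b)
    (h₁ : HasParallelFields (E := E) γ a c) (h₂ : HasParallelFields (E := E) γ c b) :
    HasParallelFields (E := E) γ a b := by
  intro s hs u
  rcases le_total s c with h | h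
  · obtain ⟨V, hV, hVs⟩ := h₁ s ⟨hs.1, h⟩ u
    obtain ⟨W, hW, hWc⟩ := h₂ c ⟨le_rfl, hcb⟩ (V c)
    obtain ⟨Z, hZ, hZV, -⟩ := hV.glue hac hcb hW hWc.symm
    exact ⟨Z, hZ, (hZV s ⟨hs.1, h⟩).trans hVs⟩
  · obtain ⟨W, hW, hWs⟩ := h₂ s ⟨h, hs.2⟩ u
    obtain ⟨V, hV, hVc⟩ := h₁ c ⟨hac, le_rfl⟩ (W c)
    obtain ⟨Z, hZ, -, hZW⟩ := hV.glue hac hcb hW hVc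
    exact ⟨Z, hZ, (hZW s ⟨h, hs.2⟩).trans hWs⟩

/-- By compactness `[a, b]` splits into finitely many pieces, each inside an interval of local
existence. -/
lemma hasParallelFields {γ : ℝ → M} (hγ : ContMDiff 𝓘(ℝ, ℝ) 𝓘(ℝ, E) ∞ γ) {a b : ℝ}
    (hab : a ≤ b) : HasParallelFields (E := E) γ a b := by
  choose δ hδ hloc using eventually_hasParallelFields (E := E) hγ
  obtain ⟨t, h0, hmono, ⟨m, hm⟩, hcov⟩ := exists_monotone_Icc_subset_open_cover_Icc hab
    (c := fun t₀ : ℝ ↦ (Subtype.val ⁻¹' Set.Ioo (t₀ - δ t₀) (t₀ + δ t₀) : Set (Set.Icc a b)))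
    (fun t₀ ↦ isOpen_Ioo.preimage continuous_subtype_val)
    (fun x _ ↦ Set.mem_iUnion.2 ⟨x, by
      have := hδ x
      exact ⟨by linarith, by linarith⟩⟩)
  have hpiece : ∀ k, HasParallelFields (E := E) γ (t k) (t (k + 1)) := by
    intro k
    obtain ⟨t₀, h⟩ := hcov k
    refine hloc t₀ _ _ fun x hx ↦ ?_
    have hx' : x ∈ Set.Icc a b := ⟨(t k).2.1.trans hx.1, hx.2.trans (t (k + 1)).2.2⟩
    exact h (show (⟨x, hx'⟩ : Set.Icc a b) ∈ Set.Icc (t k) (t (k + 1)) from ⟨hx.1, hx.2⟩)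
  have hall : ∀ k, HasParallelFields (E := E) γ (t 0) (t (k + 1)) := by
    intro k
    induction k with
    | zero => exact hpiece 0
    | succ k ih => exact ih.trans (hmono (Nat.zero_le _)) (hmono (Nat.le_succ _)) (hpiece (k + 1))
  have := hall m
  rwa [h0, hm (m + 1) (Nat.le_succ m)] at this

/-- Uniqueness makes the choice in the definition immaterial: any parallel field computes the
transport. -/
lemma parallelTransport_eq {γ : ℝ → M} (hγ : ContMDiff 𝓘(ℝ, ℝ) 𝓘(ℝ, E) ∞ γ) {a b : ℝ}
    {V : ∀ t, TangentSpace 𝓘(ℝ, E) (γ t)} (hV : IsParallelOn γ V (Set.uIcc a b)) :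
    parallelTransport γ a b ⟨γ a, V a⟩ = V b := by
  have h : ∃ W : ∀ t, TangentSpace 𝓘(ℝ, E) (γ t), IsParallelOn γ W (Set.uIcc a b) ∧
      (⟨γ a, W a⟩ : TangentBundle 𝓘(ℝ, E) M) = ⟨γ a, V a⟩ := ⟨V, hV, rfl⟩
  rw [parallelTransport, dif_pos h]
  obtain ⟨h1, h2⟩ := h.choose_spec
  exact h1.eq_of_eq (hγ.mdifferentiable (by simp)) (convex_uIcc a b) hV Set.left_mem_uIcc
    Set.right_mem_uIcc (TotalSpace.mk_inj.1 h2)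

lemma exists_isParallelOn_uIcc {γ : ℝ → M} (hγ : ContMDiff 𝓘(ℝ, ℝ) 𝓘(ℝ, E) ∞ γ) (a b : ℝ)
    (u : TangentSpace 𝓘(ℝ, E) (γ a)) : ∃ V : ∀ t, TangentSpace 𝓘(ℝ, E) (γ t),
      IsParallelOn γ V (Set.uIcc a b) ∧ V a = u :=
  hasParallelFields hγ inf_le_sup a Set.left_mem_uIcc u

/-- Parallel transport along a smooth curve is a linear isometry of tangent spaces. -/
def transportEquiv {γ : ℝ → M} (hγ : ContMDiff 𝓘(ℝ, ℝ) 𝓘(ℝ, E) ∞ γ) (a b : ℝ) :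
    TangentSpace 𝓘(ℝ, E) (γ a) ≃ₗᵢ[ℝ] TangentSpace 𝓘(ℝ, E) (γ b) where
  toFun u := parallelTransport γ a b ⟨γ a, u⟩
  invFun w := parallelTransport γ b a ⟨γ b, w⟩
  map_add' u v := by
    obtain ⟨U, hU, rfl⟩ := exists_isParallelOn_uIcc hγ a b u
    obtain ⟨V, hV, rfl⟩ := exists_isParallelOn_uIcc hγ a b v
    rw [parallelTransport_eq hγ hU, parallelTransport_eq hγ hV]
    exact parallelTransport_eq hγ (hU.add hV)
  map_smul' c u := by
    obtain ⟨U, hU, rfl⟩ := exists_isParallelOn_uIcc hγ a b u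
    rw [parallelTransport_eq hγ hU]
    exact parallelTransport_eq hγ (hU.smul c)
  -- The same field, read in the other direction, computes the transport back.
  left_inv u := by
    obtain ⟨U, hU, rfl⟩ := exists_isParallelOn_uIcc hγ a b u
    beta_reduce
    rw [parallelTransport_eq hγ hU]
    exact parallelTransport_eq hγ (Set.uIcc_comm a b ▸ hU)
  right_inv u := by
    obtain ⟨U, hU, rfl⟩ := exists_isParallelOn_uIcc hγ b a u
    beta_reduce
    rw [parallelTransport_eq hγ hU]
    exact parallelTransport_eq hγ (Set.uIcc_comm b a ▸ hU)
  norm_map' u := by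
    obtain ⟨U, hU, rfl⟩ := exists_isParallelOn_uIcc hγ a b u
    change ‖parallelTransport γ a b ⟨γ a, U a⟩‖ = _
    rw [parallelTransport_eq hγ hU, ← sq_eq_sq₀ (norm_nonneg _) (norm_nonneg _),
      ← real_inner_self_eq_norm_sq, ← real_inner_self_eq_norm_sq]
    exact hU.inner_eq (hγ.mdifferentiable (by simp)) (convex_uIcc a b) hU Set.right_mem_uIcc
      Set.left_mem_uIcc

end Existence

/-! ### Descent along geodesics -/

section Descent

variable {E : Type*} [NormedAddCommGroup E] [NormedSpace ℝ E] [FiniteDimensional ℝ E]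
  {M : Type*} [TopologicalSpace M] [ChartedSpace E M] [IsManifold 𝓘(ℝ, E) ∞ M]
  [RiemannianBundle (fun x : M ↦ TangentSpace 𝓘(ℝ, E) x)]

lemma inner_riemGrad (f : M → ℝ) (x : M) (v : TangentSpace 𝓘(ℝ, E) x) :
    inner ℝ (riemGrad f x) v = mvfderiv 𝓘(ℝ, E) f x v := by
  rw [riemGrad, InnerProductSpace.toDual_symm_apply]

lemma hasDerivAt_comp_curve {f : M → ℝ} {γ : ℝ → M} {t : ℝ}
    (hf : MDifferentiableAt 𝓘(ℝ, E) 𝓘(ℝ, ℝ) f (γ t))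
    (hγ : MDifferentiableAt 𝓘(ℝ, ℝ) 𝓘(ℝ, E) γ t) :
    HasDerivAt (fun s ↦ f (γ s)) (inner ℝ (riemGrad f (γ t)) (velocity (E := E) γ t)) t := by
  rw [inner_riemGrad]
  have key : ∀ D : ℝ →L[ℝ] ℝ, HasFDerivAt (fun s ↦ f (γ s)) D t →
      HasDerivAt (fun s ↦ f (γ s)) (D 1) t := fun D h ↦ h.hasDerivAt
  exact key _ (hf.hasMFDerivAt.comp t hγ.hasMFDerivAt).hasFDerivAt

lemma velocity_comp_mul {γ : ℝ → M} (c s : ℝ)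
    (hγ : MDifferentiableAt 𝓘(ℝ, ℝ) 𝓘(ℝ, E) γ (c * s)) :
    velocity (E := E) (fun r ↦ γ (c * r)) s = c • velocity (E := E) γ (c * s) := by
  have h1 : HasMFDerivAt 𝓘(ℝ, ℝ) 𝓘(ℝ, ℝ) (fun r : ℝ ↦ c * r) s
      (c • ContinuousLinearMap.id ℝ ℝ : ℝ →L[ℝ] ℝ) :=
    ((hasFDerivAt_id s).const_mul c).hasMFDerivAt
  have h2 := hγ.hasMFDerivAt.comp s h1
  unfold velocity
  rw [show mfderiv 𝓘(ℝ, ℝ) 𝓘(ℝ, E) (fun r ↦ γ (c * r)) s = _ from h2.mfderiv]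
  have key : ∀ D : ℝ →L[ℝ] E, (D.comp (c • ContinuousLinearMap.id ℝ ℝ)) 1 = c • D 1 := by
    intro D
    simp
  exact key _

variable [IsContMDiffRiemannianBundle 𝓘(ℝ, E) ∞ E (fun x : M ↦ TangentSpace 𝓘(ℝ, E) x)]

lemma IsGeodesic.mdifferentiable {γ : ℝ → M} (hγ : IsGeodesic (E := E) γ) :
    MDifferentiable 𝓘(ℝ, ℝ) 𝓘(ℝ, E) γ := hγ.1.mdifferentiable (by simp)

/-- The geodesic equation is homogeneous of degree two in the velocity. The rescaling turns a
hypothesis about times 0 and 1 into one about times 0 and t. -/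
lemma IsGeodesic.comp_mul {γ : ℝ → M} (hγ : IsGeodesic (E := E) γ) (c : ℝ) :
    IsGeodesic (E := E) (fun r ↦ γ (c * r)) := by
  have hmul : ContMDiff 𝓘(ℝ, ℝ) 𝓘(ℝ, ℝ) ∞ (fun r : ℝ ↦ c * r) :=
    (contDiff_const.mul contDiff_id).contMDiff
  refine ⟨hγ.1.comp hmul, fun t _ ↦ ?_⟩
  obtain ⟨v', h1, h2⟩ := hγ.2 (c * t) (Set.mem_univ _)
  rw [hasDerivWithinAt_univ] at h1
  have hd : HasDerivAt (fun r : ℝ ↦ c * r) c t := by simpa using (hasDerivAt_id t).const_mul c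
  refine ⟨c • (c • v'), ?_, fun w ↦ ?_⟩
  · rw [hasDerivWithinAt_univ]
    refine ((h1.scomp t hd).const_smul c).congr_of_eventuallyEq (.of_forall fun s ↦ ?_)
    beta_reduce
    rw [velocity_comp_mul c s (hγ.mdifferentiable _)]
    exact coords_smul _ _ _ _
  · have h3 := h2 w
    rw [← metricForm_apply, christoffelFirst_eq] at h3 ⊢
    rw [velocity_comp_mul c t (hγ.mdifferentiable _), coords_smul]
    rw [christoffelForm_apply] at h3 ⊢
    simp only [map_smul, _root_.smul_apply, smul_eq_mul]
    linear_combination c ^ 2 * h3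

lemma transportEquiv_symm_apply {γ : ℝ → M} (hγ : ContMDiff 𝓘(ℝ, ℝ) 𝓘(ℝ, E) ∞ γ) (a b : ℝ)
    (u : TangentSpace 𝓘(ℝ, E) (γ b)) :
    (transportEquiv hγ a b).symm u = parallelTransport γ b a ⟨γ b, u⟩ := rfl

lemma IsGeodesic.transportEquiv_velocity {γ : ℝ → M} (hγ : IsGeodesic (E := E) γ) (a b : ℝ) :
    transportEquiv hγ.1 a b (velocity γ a) = velocity γ b :=
  parallelTransport_eq hγ.1 (hγ.2.mono (Set.subset_univ _))

/-- Applying the isometry from `γ 0` to `γ 1` moves the comparison to the endpoint, where R-PAGE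
forms its new estimator. -/
lemma IsGSmooth.norm_sub_transport_le {L : ℝ} {f : M → ℝ} (hf : IsGSmooth E L f) {γ : ℝ → M}
    (hγ : IsGeodesic (E := E) γ) :
    ‖riemGrad (E := E) f (γ 1) - transportEquiv hγ.1 0 1 (riemGrad f (γ 0))‖
      ≤ L * ‖velocity (E := E) γ 0‖ := by
  have h := hf.2 γ hγ
  rw [← transportEquiv_symm_apply hγ.1 0 1, ← (transportEquiv hγ.1 0 1).norm_map, map_sub,
    LinearIsometryEquiv.apply_symm_apply, norm_sub_rev] at h
  exact h

/-- The velocity is parallel, so transport carries the second inner product to `γ 1`; Cauchy–Schwarz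
does the rest. -/
lemma IsGSmooth.inner_sub_inner_le {L : ℝ} {f : M → ℝ} (hf : IsGSmooth E L f) {γ : ℝ → M}
    (hγ : IsGeodesic (E := E) γ) :
    inner ℝ (riemGrad f (γ 1)) (velocity (E := E) γ 1)
      - inner ℝ (riemGrad f (γ 0)) (velocity (E := E) γ 0) ≤ L * ‖velocity (E := E) γ 0‖ ^ 2 := by
  have h := hf.norm_sub_transport_le hγ
  rw [← hγ.transportEquiv_velocity 0 1,
    ← (transportEquiv hγ.1 0 1).inner_map_map (riemGrad f (γ 0)) (velocity γ 0), ← inner_sub_left]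
  refine (real_inner_le_norm _ _).trans ?_
  rw [LinearIsometryEquiv.norm_map, sq, ← mul_assoc]
  exact mul_le_mul_of_nonneg_right h (norm_nonneg _)

/-- The descent inequality for geodesically smooth functions. -/
lemma IsGSmooth.descent {L : ℝ} {f : M → ℝ} (hf : IsGSmooth E L f) {γ : ℝ → M}
    (hγ : IsGeodesic (E := E) γ) :
    f (γ 1) ≤ f (γ 0) + inner ℝ (riemGrad f (γ 0)) (velocity (E := E) γ 0)
      + L / 2 * ‖velocity (E := E) γ 0‖ ^ 2 := by
  set φ' : ℝ → ℝ := fun t ↦ inner ℝ (riemGrad f (γ t)) (velocity (E := E) γ t) with hφ'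
  set N := ‖velocity (E := E) γ 0‖ with hN
  have hφ : ∀ t, HasDerivAt (fun s ↦ f (γ s)) (φ' t) t := fun t ↦
    hasDerivAt_comp_curve (hf.1 _) (hγ.mdifferentiable t)
  have hbound : ∀ t, 0 < t → φ' t ≤ φ' 0 + L * t * N ^ 2 := by
    intro t ht
    -- For r ↦ γ(tr) the left side gains a factor t and the right side t²; one factor is divided
    -- out.
    have h := hf.inner_sub_inner_le (hγ.comp_mul t)
    rw [velocity_comp_mul t 1 (hγ.mdifferentiable _), velocity_comp_mul t 0 (hγ.mdifferentiable _),
      inner_smul_right, inner_smul_right, norm_smul] at h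
    have e1 : inner ℝ (riemGrad f (γ (t * 1))) (velocity (E := E) γ (t * 1)) = φ' t :=
      congrArg φ' (mul_one t)
    have e0 : inner ℝ (riemGrad f (γ (t * 0))) (velocity (E := E) γ (t * 0)) = φ' 0 :=
      congrArg φ' (mul_zero t)
    have eN : ‖velocity (E := E) γ (t * 0)‖ = N :=
      congrArg (fun r ↦ ‖velocity (E := E) γ r‖) (mul_zero t)
    rw [e1, e0, eN, Real.norm_of_nonneg ht.le] at h
    have : t * (φ' t - φ' 0) ≤ t * (L * t * N ^ 2) := by linarith
    linarith [le_of_mul_le_mul_left this ht]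
  -- Monotonicity of the difference from the quadratic replaces integration, so integrability of
  -- `φ'` is not needed.
  have hψ : ∀ t, HasDerivAt (fun s ↦ f (γ s) - (s * φ' 0 + L / 2 * s ^ 2 * N ^ 2))
      (φ' t - (φ' 0 + L * t * N ^ 2)) t := by
    intro t
    have h1 := (((hasDerivAt_id t).mul_const (φ' 0)).add
      ((((hasDerivAt_pow 2 t).const_mul (L / 2)).mul_const (N ^ 2))))
    refine ((hφ t).sub h1).congr_deriv ?_
    push_cast
    ring
  have hanti : AntitoneOn (fun s ↦ f (γ s) - (s * φ' 0 + L / 2 * s ^ 2 * N ^ 2))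
      (Set.Icc 0 1) := by
    refine antitoneOn_of_deriv_nonpos (convex_Icc 0 1)
      (fun t _ ↦ (hψ t).continuousAt.continuousWithinAt)
      (fun t _ ↦ (hψ t).differentiableAt.differentiableWithinAt) fun t ht ↦ ?_
    rw [interior_Icc] at ht
    rw [(hψ t).deriv]
    linarith [hbound t ht.1]
  have := hanti (Set.left_mem_Icc.2 zero_le_one) (Set.right_mem_Icc.2 zero_le_one) zero_le_one
  simp only at this
  linarith

lemma riemGrad_objective {n : ℕ} {f : Fin n → M → ℝ}
    (hf : ∀ i, MDifferentiable 𝓘(ℝ, E) 𝓘(ℝ, ℝ) (f i)) (x : M) :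
    riemGrad (E := E) (objective f) x = batchGrad f Finset.univ x := by
  have hi : ∀ i ∈ Finset.univ, HasMFDerivAt 𝓘(ℝ, E) 𝓘(ℝ, ℝ) (f i) x
      (mvfderiv 𝓘(ℝ, E) (f i) x : TangentSpace 𝓘(ℝ, E) x →L[ℝ] ℝ) :=
    fun i _ ↦ (hf i x).hasMFDerivAt
  have hsum := (HasMFDerivAt.sum hi).const_smul (n : ℝ)⁻¹
  have hobj : (n : ℝ)⁻¹ • ∑ i, f i = objective f := by
    ext y
    simp [objective, div_eq_inv_mul]
  rw [hobj] at hsum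
  have hD : mvfderiv 𝓘(ℝ, E) (objective f) x
      = (n : ℝ)⁻¹ • ∑ i, (mvfderiv 𝓘(ℝ, E) (f i) x : TangentSpace 𝓘(ℝ, E) x →L[ℝ] ℝ) :=
    hsum.mfderiv
  refine ext_inner_right ℝ fun v ↦ ?_
  rw [inner_riemGrad, batchGrad, real_inner_smul_left, sum_inner, hD]
  simp [inner_riemGrad]

lemma objective_descent {n : ℕ} (hn : n ≠ 0) {L : ℝ} {f : Fin n → M → ℝ}
    (hf : ∀ i, IsGSmooth E L (f i)) {γ : ℝ → M} (hγ : IsGeodesic (E := E) γ) :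
    objective f (γ 1) ≤ objective f (γ 0)
      + inner ℝ (batchGrad f Finset.univ (γ 0)) (velocity (E := E) γ 0)
      + L / 2 * ‖velocity (E := E) γ 0‖ ^ 2 := by
  have hn' : (0 : ℝ) < n := by positivity
  have h := Finset.sum_le_sum fun i (_ : i ∈ Finset.univ) ↦ (hf i).descent hγ
  rw [Finset.sum_add_distrib, Finset.sum_add_distrib, ← sum_inner, Finset.sum_const,
    Finset.card_univ, Fintype.card_fin, nsmul_eq_mul] at h
  rw [objective, objective, batchGrad, real_inner_smul_left, Finset.card_univ, Fintype.card_fin]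
  rw [div_le_iff₀ hn']
  refine h.trans (le_of_eq ?_)
  field_simp

end Descent

/-! ### Variance of sampling without replacement -/

section Sampling

variable {H : Type*} [NormedAddCommGroup H] [InnerProductSpace ℝ H] {n b : ℕ}

/-- Double counting: each index lies in C(n − 1, b − 1) of the subsets. -/
lemma sum_powersetCard_sum {A : Type*} [AddCommMonoid A] (hb : 1 ≤ b) (Y : Fin n → A) :
    ∑ S ∈ Finset.powersetCard b Finset.univ, ∑ i ∈ S, Y i
      = ((n - 1).choose (b - 1)) • ∑ i, Y i := by
  have h1 : ∀ S ∈ Finset.powersetCard b (Finset.univ : Finset (Fin n)),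
      ∑ i ∈ S, Y i = ∑ i, if i ∈ S then Y i else 0 := fun S _ ↦ by simp
  rw [Finset.sum_congr rfl h1, Finset.sum_comm, Finset.smul_sum]
  refine Finset.sum_congr rfl fun i _ ↦ ?_
  rw [← Finset.sum_filter, Finset.sum_const]
  congr 1
  have h := Finset.card_filter_powersetCard_subset {i} Finset.univ b (by simp) (by simpa using hb)
  simpa using h

/-- Expanding the squares, a diagonal pair is counted α times and every other pair β times. Since
the `Y i` sum to zero, the total is (α − β)∑‖Yᵢ‖², and β ≥ 0. -/
lemma sum_powersetCard_norm_sq_le (hb : 1 ≤ b) (Y : Fin n → H) (hY : ∑ i, Y i = 0) :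
    ∑ S ∈ Finset.powersetCard b Finset.univ, ‖∑ i ∈ S, Y i‖ ^ 2
      ≤ ((n - 1).choose (b - 1)) * ∑ i, ‖Y i‖ ^ 2 := by
  classical
  set P := Finset.powersetCard b (Finset.univ : Finset (Fin n)) with hP
  have h1 : ∀ S ∈ P, ‖∑ i ∈ S, Y i‖ ^ 2
      = ∑ i, ∑ j, if i ∈ S ∧ j ∈ S then inner ℝ (Y i) (Y j) else 0 := by
    intro S _
    rw [← real_inner_self_eq_norm_sq, sum_inner]
    simp only [inner_sum, ite_and, Finset.sum_ite_mem, Finset.univ_inter,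
      Finset.sum_ite_irrel, Finset.sum_const_zero]
  set α : ℝ := ((n - 1).choose (b - 1) : ℝ)
  obtain ⟨β, hβ0, hβ⟩ : ∃ β : ℝ, 0 ≤ β ∧ ∀ i j : Fin n, i ≠ j →
      ((P.filter fun S ↦ i ∈ S ∧ j ∈ S).card : ℝ) = β := by
    -- For `b = 1` no subset contains a pair, but truncated subtraction would make the binomial
    -- coefficient 1.
    by_cases hb2 : 2 ≤ b
    · refine ⟨((n - 2).choose (b - 2) : ℝ), by positivity, fun i j hij ↦ ?_⟩
      have h := Finset.card_filter_powersetCard_subset {i, j} Finset.univ b (by simp)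
        (by rw [Finset.card_pair hij]; exact hb2)
      rw [Finset.card_pair hij] at h
      simp only [Finset.insert_subset_iff, Finset.singleton_subset_iff, Finset.card_univ,
        Fintype.card_fin] at h
      exact_mod_cast h
    · refine ⟨0, le_rfl, fun i j hij ↦ ?_⟩
      rw [Nat.cast_eq_zero, Finset.card_eq_zero, Finset.filter_eq_empty_iff]
      rintro S hS ⟨hi, hj⟩
      have hc := (Finset.mem_powersetCard.1 hS).2
      have := Finset.card_le_card (show {i, j} ⊆ S by
        simp [Finset.insert_subset_iff, hi, hj])
      rw [Finset.card_pair hij] at this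
      omega
  have hα : ∀ i : Fin n, ((P.filter fun S ↦ i ∈ S ∧ i ∈ S).card : ℝ) = α := by
    intro i
    have h := Finset.card_filter_powersetCard_subset {i} Finset.univ b (by simp) (by simpa using hb)
    simp only [Finset.singleton_subset_iff, Finset.card_univ, Fintype.card_fin,
      Finset.card_singleton] at h
    simp only [and_self, α]
    exact_mod_cast h
  rw [Finset.sum_congr rfl h1, Finset.sum_comm]
  have h2 : ∀ i, ∑ S ∈ P, ∑ j, (if i ∈ S ∧ j ∈ S then inner ℝ (Y i) (Y j) else 0)
      = (α - β) * ‖Y i‖ ^ 2 + β * inner ℝ (Y i) (∑ j, Y j) := by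
    intro i
    rw [Finset.sum_comm]
    have h3 : ∀ j, ∑ S ∈ P, (if i ∈ S ∧ j ∈ S then inner ℝ (Y i) (Y j) else 0)
        = (if i = j then (α - β) * inner ℝ (Y i) (Y j) else 0) + β * inner ℝ (Y i) (Y j) := by
      intro j
      rw [← Finset.sum_filter, Finset.sum_const, nsmul_eq_mul]
      by_cases hij : i = j
      · subst hij
        rw [hα, if_pos rfl]
        ring
      · rw [hβ i j hij, if_neg hij, zero_add]
    simp only [h3, Finset.sum_add_distrib, Finset.sum_ite_eq, Finset.mem_univ, if_true,
      ← Finset.mul_sum, inner_sum, real_inner_self_eq_norm_sq]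
  rw [Finset.sum_congr rfl fun i _ ↦ h2 i]
  simp only [hY, inner_zero_right, mul_zero, add_zero, ← Finset.mul_sum]
  refine mul_le_mul_of_nonneg_right (by linarith) (by positivity)

/-- The mean square error of a minibatch average, sampled without replacement. -/
lemma sum_powersetCard_sampling_error_le (hb : 1 ≤ b) (hn : n ≠ 0) (X : Fin n → H) (e : H) :
    ∑ S ∈ Finset.powersetCard b Finset.univ,
        ‖e + ((b : ℝ)⁻¹ • ∑ i ∈ S, X i - (n : ℝ)⁻¹ • ∑ i, X i)‖ ^ 2
      ≤ (n.choose b : ℝ) * (‖e‖ ^ 2 + (∑ i, ‖X i‖ ^ 2) / (b * n)) := by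
  have hn' : (0 : ℝ) < n := by positivity
  have hb' : (0 : ℝ) < b := by positivity
  set m := (n : ℝ)⁻¹ • ∑ i, X i with hm
  -- Centring makes the cross term with `e` vanish on average and can only lower the sum of squares.
  set Y : Fin n → H := fun i ↦ X i - m with hYdef
  have hYsum : ∑ i, Y i = 0 := by
    simp only [hYdef, Finset.sum_sub_distrib, Finset.sum_const, Finset.card_univ, Fintype.card_fin,
      hm, ← Nat.cast_smul_eq_nsmul ℝ]
    rw [smul_inv_smul₀ hn'.ne', sub_self]
  have hY2 : ∑ i, ‖Y i‖ ^ 2 ≤ ∑ i, ‖X i‖ ^ 2 := by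
    have h : ∀ i, ‖X i‖ ^ 2 = ‖Y i‖ ^ 2 + 2 * inner ℝ (Y i) m + ‖m‖ ^ 2 := fun i ↦ by
      rw [← norm_add_sq_real, hYdef]
      simp
    rw [Finset.sum_congr rfl fun i _ ↦ h i, Finset.sum_add_distrib, Finset.sum_add_distrib,
      ← Finset.mul_sum, ← sum_inner, hYsum]
    simp
    positivity
  have hS : ∀ S ∈ Finset.powersetCard b (Finset.univ : Finset (Fin n)),
      ‖e + ((b : ℝ)⁻¹ • ∑ i ∈ S, X i - m)‖ ^ 2
        = ‖e‖ ^ 2 + 2 * (b : ℝ)⁻¹ * inner ℝ e (∑ i ∈ S, Y i)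
          + ((b : ℝ)⁻¹) ^ 2 * ‖∑ i ∈ S, Y i‖ ^ 2 := by
    intro S hS
    have hc := (Finset.mem_powersetCard.1 hS).2
    have : (b : ℝ)⁻¹ • ∑ i ∈ S, X i - m = (b : ℝ)⁻¹ • ∑ i ∈ S, Y i := by
      simp only [hYdef, Finset.sum_sub_distrib, Finset.sum_const, hc, smul_sub,
        ← Nat.cast_smul_eq_nsmul ℝ]
      rw [inv_smul_smul₀ hb'.ne']
    rw [this, norm_add_sq_real, inner_smul_right, norm_smul, mul_pow, Real.norm_of_nonneg
      (by positivity)]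
    ring
  rw [Finset.sum_congr rfl hS, Finset.sum_add_distrib, Finset.sum_add_distrib, ← Finset.mul_sum,
    ← Finset.mul_sum, ← inner_sum, sum_powersetCard_sum hb, hYsum, Finset.sum_const,
    Finset.card_powersetCard, Finset.card_univ, Fintype.card_fin]
  have h1 := (sum_powersetCard_norm_sq_le hb Y hYsum).trans
    (mul_le_mul_of_nonneg_left hY2 (by positivity))
  have h2 : ((n - 1).choose (b - 1) : ℝ) * n = n.choose b * b := by
    obtain ⟨k, rfl⟩ := Nat.exists_eq_succ_of_ne_zero hn
    obtain ⟨c, rfl⟩ := Nat.exists_eq_succ_of_ne_zero (show b ≠ 0 by omega)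
    have := Nat.add_one_mul_choose_eq k c
    simp only [Nat.succ_eq_add_one, Nat.add_sub_cancel]
    rw [mul_comm]
    exact_mod_cast this
  have h3 : ((n - 1).choose (b - 1) : ℝ) = n.choose b * b / n := by
    rw [eq_div_iff hn'.ne', h2]
  rw [h3] at h1
  have h4 := mul_le_mul_of_nonneg_left h1 (show 0 ≤ ((b : ℝ)⁻¹) ^ 2 by positivity)
  simp only [nsmul_eq_mul, smul_zero, inner_zero_right, mul_zero, add_zero]
  rw [mul_add]
  refine add_le_add le_rfl (h4.trans (le_of_eq ?_))
  field_simp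

end Sampling

/-! ### One iteration: error recursion and decrease of the Lyapunov function -/

section Step

variable {E : Type*} [NormedAddCommGroup E] [NormedSpace ℝ E] [FiniteDimensional ℝ E]
  {M : Type*} [TopologicalSpace M] [ChartedSpace E M] [IsManifold 𝓘(ℝ, E) ∞ M]
  [RiemannianBundle (fun x : M ↦ TangentSpace 𝓘(ℝ, E) x)] {n : ℕ}

/-- One iteration of R-PAGE. -/
def pageStep (f : Fin n → M → ℝ) (η : ℝ) (s : TangentBundle 𝓘(ℝ, E) M) (c : Bool)
    (S : Finset (Fin n)) : TangentBundle 𝓘(ℝ, E) M :=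
  let step : TangentBundle 𝓘(ℝ, E) M := ⟨s.proj, -(η • s.snd)⟩
  let y : M := riemExp step
  let transport : TangentBundle 𝓘(ℝ, E) M → TangentSpace 𝓘(ℝ, E) y :=
    parallelTransport (expCurve step) 0 1
  ⟨y, if c then batchGrad f Finset.univ y
      else transport s + batchGrad f S y - transport ⟨s.proj, batchGrad f S s.proj⟩⟩

lemma iterate_succ (f : Fin n → M → ℝ) (η : ℝ) (x₀ : M) (coin : ℕ → Bool)
    (batch : ℕ → Finset (Fin n)) (k : ℕ) :
    iterate (E := E) f η x₀ coin batch (k + 1)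
      = pageStep f η (iterate (E := E) f η x₀ coin batch k) (coin k) (batch k) := rfl

/-- The squared norm of the error of the gradient estimator. -/
def gradError (f : Fin n → M → ℝ) (s : TangentBundle 𝓘(ℝ, E) M) : ℝ :=
  ‖s.snd - batchGrad f Finset.univ s.proj‖ ^ 2

lemma gradError_pageStep_true (f : Fin n → M → ℝ) (η : ℝ) (s : TangentBundle 𝓘(ℝ, E) M)
    (S : Finset (Fin n)) : gradError f (pageStep f η s true S) = 0 := by
  have h : gradError f (pageStep f η s true S)
      = ‖batchGrad (E := E) f Finset.univ (riemExp ⟨s.proj, -(η • s.snd)⟩)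
        - batchGrad f Finset.univ (riemExp ⟨s.proj, -(η • s.snd)⟩)‖ ^ 2 := rfl
  rw [h, sub_self, norm_zero, zero_pow two_ne_zero]

lemma expCurve_spec (hM : IsGeodesicallyComplete E M) (xv : TangentBundle 𝓘(ℝ, E) M) :
    IsGeodesicFrom (expCurve xv) xv := by
  rw [expCurve, dif_pos (hM xv)]
  exact (hM xv).choose_spec

variable [IsContMDiffRiemannianBundle 𝓘(ℝ, E) ∞ E (fun x : M ↦ TangentSpace 𝓘(ℝ, E) x)]

lemma objective_pageStep_le (hM : IsGeodesicallyComplete E M) (hn : n ≠ 0) {L : ℝ}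
    {f : Fin n → M → ℝ} (hf : ∀ i, IsGSmooth E L (f i)) (η : ℝ)
    (s : TangentBundle 𝓘(ℝ, E) M) (c : Bool) (S : Finset (Fin n)) :
    objective f (pageStep f η s c S).proj ≤ objective f s.proj
      - η * inner ℝ (batchGrad f Finset.univ s.proj) s.snd + L / 2 * (η ^ 2 * ‖s.snd‖ ^ 2) := by
  obtain ⟨x, g⟩ := s
  obtain ⟨hγ, h0⟩ := expCurve_spec hM ⟨x, -(η • g)⟩
  change objective f (expCurve ⟨x, -(η • g)⟩ 1) ≤ objective f x
      - η * inner ℝ (batchGrad f Finset.univ x) g + L / 2 * (η ^ 2 * ‖g‖ ^ 2)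
  generalize hv : -(η • g) = v at hγ h0 ⊢
  generalize expCurve ⟨x, v⟩ = γ at hγ h0 ⊢
  -- Once the curve and its initial vector are generalized, this replaces `x` and `v` by `γ 0` and
  -- `velocity γ 0`, avoiding casts between tangent spaces.
  cases h0
  have h := objective_descent hn hf hγ
  rw [← hv, inner_neg_right, inner_smul_right, norm_neg, norm_smul, mul_pow, Real.norm_eq_abs,
    sq_abs] at h
  linarith

/-- The new error is the transported old error plus the deviation of a minibatch mean of Xᵢ = ∇fᵢ(y)
− T∇fᵢ(x) from the full mean. The transport T is an isometry, and smoothness gives ‖Xᵢ‖ ≤ L|η|‖g‖.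
-/
lemma sum_gradError_pageStep_false_le (hM : IsGeodesicallyComplete E M) (hn : n ≠ 0) {b : ℕ}
    (hb : 1 ≤ b) {L : ℝ} {f : Fin n → M → ℝ} (hf : ∀ i, IsGSmooth E L (f i)) (η : ℝ)
    (s : TangentBundle 𝓘(ℝ, E) M) :
    ∑ S ∈ Finset.powersetCard b Finset.univ, gradError f (pageStep f η s false S)
      ≤ (n.choose b : ℝ) * (gradError f s + L ^ 2 * η ^ 2 / b * ‖s.snd‖ ^ 2) := by
  obtain ⟨x, g⟩ := s
  obtain ⟨hγ, h0⟩ := expCurve_spec hM ⟨x, -(η • g)⟩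
  have hstep : ∀ S, gradError f (pageStep f η ⟨x, g⟩ false S)
      = ‖parallelTransport (expCurve ⟨x, -(η • g)⟩) 0 1 ⟨x, g⟩
          + batchGrad f S (expCurve ⟨x, -(η • g)⟩ 1)
          - parallelTransport (expCurve ⟨x, -(η • g)⟩) 0 1 ⟨x, batchGrad f S x⟩
          - batchGrad f Finset.univ (expCurve ⟨x, -(η • g)⟩ 1)‖ ^ 2 := fun S ↦ rfl
  simp only [hstep]
  change _ ≤ (n.choose b : ℝ) * (‖g - batchGrad f Finset.univ x‖ ^ 2
    + L ^ 2 * η ^ 2 / b * ‖g‖ ^ 2)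
  generalize hv : -(η • g) = v at hγ h0 ⊢
  generalize expCurve ⟨x, v⟩ = γ at hγ h0 ⊢
  cases h0
  set T := transportEquiv hγ.1 0 1 with hT
  have hTa : ∀ u, parallelTransport γ 0 1 ⟨γ 0, u⟩ = T u := fun u ↦ rfl
  simp only [hTa]
  set X : Fin n → TangentSpace 𝓘(ℝ, E) (γ 1) := fun i ↦
    riemGrad (f i) (γ 1) - T (riemGrad (f i) (γ 0)) with hX
  have hsum : ∀ S : Finset (Fin n),
      (S.card : ℝ)⁻¹ • ∑ i ∈ S, X i = batchGrad f S (γ 1) - T (batchGrad f S (γ 0)) := by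
    intro S
    simp only [hX, batchGrad, Finset.sum_sub_distrib, smul_sub, map_smul, map_sum]
  have hXn : ∑ i, ‖X i‖ ^ 2 ≤ n * (L ^ 2 * η ^ 2 * ‖g‖ ^ 2) := by
    have hi : ∀ i ∈ Finset.univ, ‖X i‖ ^ 2 ≤ L ^ 2 * η ^ 2 * ‖g‖ ^ 2 := by
      intro i _
      have h := (hf i).norm_sub_transport_le hγ
      rw [← hv, norm_neg, norm_smul, Real.norm_eq_abs] at h
      calc ‖X i‖ ^ 2 ≤ (L * (|η| * ‖g‖)) ^ 2 := by gcongr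
        _ = L ^ 2 * η ^ 2 * ‖g‖ ^ 2 := by rw [mul_pow, mul_pow, sq_abs]; ring
    refine (Finset.sum_le_sum hi).trans (le_of_eq ?_)
    simp
  have hmain := sum_powersetCard_sampling_error_le hb hn X (T (g - batchGrad f Finset.univ (γ 0)))
  rw [T.norm_map] at hmain
  have hn' : (0 : ℝ) < n := by positivity
  have hb' : (0 : ℝ) < b := by positivity
  calc _ = ∑ S ∈ Finset.powersetCard b Finset.univ,
        ‖T (g - batchGrad f Finset.univ (γ 0))
          + ((b : ℝ)⁻¹ • ∑ i ∈ S, X i - (n : ℝ)⁻¹ • ∑ i, X i)‖ ^ 2 := by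
        refine Finset.sum_congr rfl fun S hS ↦ ?_
        have h1 := hsum S
        have h2 := hsum Finset.univ
        rw [(Finset.mem_powersetCard.1 hS).2] at h1
        rw [Finset.card_univ, Fintype.card_fin] at h2
        rw [h1, h2, map_sub]
        congr 2
        abel
    _ ≤ _ := hmain
    _ ≤ _ := by
        refine mul_le_mul_of_nonneg_left (add_le_add le_rfl ?_) (by positivity)
        calc (∑ i, ‖X i‖ ^ 2) / (b * n) ≤ n * (L ^ 2 * η ^ 2 * ‖g‖ ^ 2) / (b * n) := by gcongr
          _ = _ := by field_simp

/-- The Lyapunov function of R-PAGE. -/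
def potential (f : Fin n → M → ℝ) (fstar η p : ℝ) (s : TangentBundle 𝓘(ℝ, E) M) : ℝ :=
  objective f s.proj - fstar + η / (2 * p) * gradError f s

/-- The probability of an outcome of the coin and of the minibatch. -/
def outcomeWeight (n b : ℕ) (p : ℝ) (z : Bool × Finset (Fin n)) : ℝ :=
  (if z.1 then p else 1 - p) * if z.2.card = b then 1 / (n.choose b : ℝ) else 0

lemma sum_outcomeWeight_mul (b : ℕ) (p : ℝ) (F : Bool × Finset (Fin n) → ℝ) :
    ∑ z, outcomeWeight n b p z * F z
      = p * ((∑ S ∈ Finset.powersetCard b Finset.univ, F (true, S)) / n.choose b)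
        + (1 - p) * ((∑ S ∈ Finset.powersetCard b Finset.univ, F (false, S)) / n.choose b) := by
  have key : ∀ (q : ℝ) (G : Finset (Fin n) → ℝ),
      ∑ S, q * (if S.card = b then 1 / (n.choose b : ℝ) else 0) * G S
        = q * ((∑ S ∈ Finset.powersetCard b Finset.univ, G S) / n.choose b) := by
    intro q G
    rw [← Finset.powerset_univ, Finset.powersetCard_eq_filter, Finset.sum_filter,
      Finset.sum_div, Finset.mul_sum]
    refine Finset.sum_congr rfl fun S _ ↦ ?_
    split_ifs <;> ring
  rw [Fintype.sum_prod_type, Fintype.sum_bool]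
  simp only [outcomeWeight, if_true, Bool.false_eq_true, if_false]
  rw [key p, key (1 - p)]

/-- Since (1 − p)·η/(2p) = η/(2p) − η/2, the average releases −(η/2)‖g − ∇f‖². Expanded, this
cancels −η⟨∇f, g⟩ and leaves −(η/2)‖∇f‖² and −(η/2)‖g‖²; `hstep` makes the latter absorb the
remaining multiples of ‖g‖². -/
lemma sum_outcomeWeight_mul_potential_le (hM : IsGeodesicallyComplete E M) (hn : n ≠ 0) {b : ℕ}
    (hb : 1 ≤ b) (hbn : b ≤ n) {L : ℝ} {f : Fin n → M → ℝ}
    (hf : ∀ i, IsGSmooth E L (f i)) (fstar : ℝ) {η p : ℝ} (hη : 0 < η) (hp : 0 < p) (hp1 : p ≤ 1)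
    (hstep : (1 - p) / (p * b) * (L * η) ^ 2 ≤ 1 - L * η) (s : TangentBundle 𝓘(ℝ, E) M) :
    ∑ z, outcomeWeight n b p z * potential f fstar η p (pageStep f η s z.1 z.2)
      ≤ potential f fstar η p s - η / 2 * ‖batchGrad (E := E) f Finset.univ s.proj‖ ^ 2 := by
  have hC : (0 : ℝ) < n.choose b := by exact_mod_cast Nat.choose_pos hbn
  set C : ℝ := (n.choose b : ℝ) with hCdef
  set P := Finset.powersetCard b (Finset.univ : Finset (Fin n)) with hP
  have hcard : (P.card : ℝ) = C := by
    rw [hP, Finset.card_powersetCard, Finset.card_univ, Fintype.card_fin]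
  set D : ℝ := objective f s.proj - η * inner ℝ (batchGrad f Finset.univ s.proj) s.snd
    + L / 2 * (η ^ 2 * ‖s.snd‖ ^ 2) - fstar with hD
  have hdesc : ∀ c S, potential f fstar η p (pageStep f η s c S)
      ≤ D + η / (2 * p) * gradError f (pageStep f η s c S) := by
    intro c S
    have := objective_pageStep_le hM hn hf η s c S
    unfold potential
    linarith
  have htrue : (∑ S ∈ P, potential f fstar η p (pageStep f η s true S)) / C ≤ D := by
    rw [div_le_iff₀ hC]
    have : ∀ S ∈ P, potential f fstar η p (pageStep f η s true S) ≤ D := by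
      intro S _
      have := hdesc true S
      rwa [gradError_pageStep_true, mul_zero, add_zero] at this
    refine (Finset.sum_le_sum this).trans (le_of_eq ?_)
    rw [Finset.sum_const, nsmul_eq_mul, hcard, mul_comm]
  have hfalse : (∑ S ∈ P, potential f fstar η p (pageStep f η s false S)) / C
      ≤ D + η / (2 * p) * (gradError f s + L ^ 2 * η ^ 2 / b * ‖s.snd‖ ^ 2) := by
    rw [div_le_iff₀ hC]
    refine (Finset.sum_le_sum fun S _ ↦ hdesc false S).trans ?_
    rw [Finset.sum_add_distrib, Finset.sum_const, nsmul_eq_mul, hcard, ← Finset.mul_sum]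
    have h := mul_le_mul_of_nonneg_left (sum_gradError_pageStep_false_le hM hn hb hf η s)
      (show 0 ≤ η / (2 * p) by positivity)
    linarith
  rw [sum_outcomeWeight_mul]
  have h1 := mul_le_mul_of_nonneg_left htrue hp.le
  have h2 := mul_le_mul_of_nonneg_left hfalse (sub_nonneg.2 hp1)
  refine (add_le_add h1 h2).trans ?_
  have hnorm : gradError f s = ‖s.snd‖ ^ 2 - 2 * inner ℝ (batchGrad f Finset.univ s.proj) s.snd
      + ‖batchGrad (E := E) f Finset.univ s.proj‖ ^ 2 := by
    rw [gradError, norm_sub_sq_real, real_inner_comm]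
  have hb' : (0 : ℝ) < b := by positivity
  have h3 := mul_le_mul_of_nonneg_right hstep
    (show 0 ≤ η / 2 * ‖s.snd‖ ^ 2 by positivity)
  have h4 : (1 - p) * (η / (2 * p) * (gradError f s + L ^ 2 * η ^ 2 / b * ‖s.snd‖ ^ 2))
      = η / (2 * p) * gradError f s - η / 2 * gradError f s
        + (1 - p) / (p * b) * (L * η) ^ 2 * (η / 2 * ‖s.snd‖ ^ 2) := by
    field_simp
  unfold potential
  have h5 : p * D + (1 - p) * (D + η / (2 * p) * (gradError f s + L ^ 2 * η ^ 2 / b * ‖s.snd‖ ^ 2))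
      = D + (1 - p) * (η / (2 * p) * (gradError f s + L ^ 2 * η ^ 2 / b * ‖s.snd‖ ^ 2)) := by ring
  rw [h5, h4, hD]
  have h6 := congrArg (fun r ↦ η / 2 * r) hnorm
  linarith

end Step

/-! ### Finite randomness and independence of the past -/

section Expectation

variable {Ω : Type*} [MeasurableSpace Ω] {P : Measure Ω} [IsProbabilityMeasure P]

lemma integrable_comp_of_finite {α : Type*} [Finite α] [MeasurableSpace α]
    [DiscreteMeasurableSpace α] {X : Ω → α} (hX : Measurable X) (h : α → ℝ) :
    Integrable (fun ξ ↦ h (X ξ)) P :=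
  have : IsProbabilityMeasure (P.map X) := Measure.isProbabilityMeasure_map hX.aemeasurable
  (Integrable.of_finite (μ := P.map X) (f := h)).comp_measurable hX

lemma integral_comp_eq_sum {α : Type*} [Fintype α] [MeasurableSpace α]
    [DiscreteMeasurableSpace α] {X : Ω → α} (hX : Measurable X) (h : α → ℝ) :
    ∫ ξ, h (X ξ) ∂P = ∑ a, P.real {ξ | X ξ = a} * h a := by
  have : IsProbabilityMeasure (P.map X) := Measure.isProbabilityMeasure_map hX.aemeasurable
  rw [← integral_map hX.aemeasurable (Integrable.of_finite (μ := P.map X)).aestronglyMeasurable,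
    integral_fintype (Integrable.of_finite)]
  refine Finset.sum_congr rfl fun a _ ↦ ?_
  rw [map_measureReal_apply hX (measurableSet_singleton a), smul_eq_mul]
  rfl

/-- The expectation of a function of two independent finite random variables, averaging over the
second one first. -/
lemma integral_comp_le_of_indepFun {α β : Type*} [Fintype α] [Fintype β] [MeasurableSpace α]
    [MeasurableSpace β] [DiscreteMeasurableSpace α] [DiscreteMeasurableSpace β]
    {X : Ω → α} {Z : Ω → β} (hX : Measurable X) (hZ : Measurable Z) (hXZ : IndepFun X Z P)
    {F : α → β → ℝ} {G : α → ℝ} (hFG : ∀ a, ∑ z, P.real {ξ | Z ξ = z} * F a z ≤ G a) :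
    ∫ ξ, F (X ξ) (Z ξ) ∂P ≤ ∫ ξ, G (X ξ) ∂P := by
  have h1 := integral_comp_eq_sum (P := P) (hX.prodMk hZ) (fun y ↦ F y.1 y.2)
  simp only at h1
  rw [h1, integral_comp_eq_sum hX G, Fintype.sum_prod_type]
  refine Finset.sum_le_sum fun a _ ↦ ?_
  have h2 : ∀ z, P.real {ξ | (X ξ, Z ξ) = (a, z)}
      = P.real {ξ | X ξ = a} * P.real {ξ | Z ξ = z} := by
    intro z
    have h := hXZ.measure_inter_preimage_eq_mul {a} {z} (measurableSet_singleton a)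
      (measurableSet_singleton z)
    rw [measureReal_def, measureReal_def, measureReal_def, ← ENNReal.toReal_mul]
    have e : {ξ | (X ξ, Z ξ) = (a, z)} = X ⁻¹' {a} ∩ Z ⁻¹' {z} := by
      ext ξ
      simp
    rw [e, h]
    rfl
  simp only [h2, mul_assoc, ← Finset.mul_sum]
  exact mul_le_mul_of_nonneg_left (hFG a) measureReal_nonneg

variable {n b K : ℕ} {p : ℝ} {coin : ℕ → Ω → Bool} {batch : ℕ → Ω → Finset (Fin n)}
  {idx : Ω → Fin K}

lemma IsRandomness.measurable_outcome (h : IsRandomness P n b K p coin batch idx) (k : ℕ) :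
    Measurable fun ξ ↦ (coin k ξ, batch k ξ) :=
  (h.measurable_coin k).prodMk (h.measurable_batch k)

lemma IsRandomness.coin_false (h : IsRandomness P n b K p coin batch idx) (k : ℕ) :
    P.real {ξ | coin k ξ = false} = 1 - p := by
  have e : {ξ | coin k ξ = false} = {ξ | coin k ξ = true}ᶜ := by
    ext ξ
    simp
  have hm : MeasurableSet {ξ | coin k ξ = true} :=
    h.measurable_coin k (measurableSet_singleton true)
  rw [e, probReal_compl_eq_one_sub hm, h.coin_law k]

lemma IsRandomness.outcome_law (h : IsRandomness P n b K p coin batch idx) (k : ℕ)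
    (z : Bool × Finset (Fin n)) :
    P.real {ξ | (coin k ξ, batch k ξ) = z} = outcomeWeight n b p z := by
  obtain ⟨c, S⟩ := z
  have h1 : P.real {ξ | (coin k ξ, batch k ξ) = (c, S)}
      = P.real {ξ | coin k ξ = c} * P.real {ξ | batch k ξ = S} := by
    have hi := (h.indep_coin_batch k).measure_inter_preimage_eq_mul {c} {S}
      (measurableSet_singleton c) (measurableSet_singleton S)
    rw [measureReal_def, measureReal_def, measureReal_def, ← ENNReal.toReal_mul]
    have e : {ξ | (coin k ξ, batch k ξ) = (c, S)} = coin k ⁻¹' {c} ∩ batch k ⁻¹' {S} := by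
      ext ξ
      simp
    rw [e, hi]
    rfl
  rw [h1, outcomeWeight]
  congr 1
  · cases c
    · simpa using h.coin_false k
    · simpa using h.coin_law k
  · split_ifs with hS
    · exact h.batch_law k S hS
    · have h0 : P {ξ | batch k ξ = S} = 0 := by
        refine measure_mono_null (fun ξ hξ ↦ ?_) (h.batch_card k)
        intro hcard
        exact hS (by rw [← hξ]; exact hcard)
      rw [measureReal_def, h0, ENNReal.toReal_zero]

/-- The outcomes of the first `k` iterations. -/
def outcomePrefix (coin : ℕ → Ω → Bool) (batch : ℕ → Ω → Finset (Fin n)) (k : ℕ) (ξ : Ω) :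
    Finset.range k → Bool × Finset (Fin n) :=
  fun i ↦ (coin i ξ, batch i ξ)

lemma IsRandomness.measurable_outcomePrefix (h : IsRandomness P n b K p coin batch idx) (k : ℕ) :
    Measurable (outcomePrefix coin batch k) :=
  measurable_pi_lambda _ fun i ↦ h.measurable_outcome i

/-- This replaces conditioning on the past: the current outcome can be averaged with the prefix held
fixed. -/
lemma IsRandomness.indepFun_outcomePrefix (h : IsRandomness P n b K p coin batch idx) (k : ℕ) :
    IndepFun (outcomePrefix coin batch k) (fun ξ ↦ (coin k ξ, batch k ξ)) P := by
  have h1 := h.indep_iterations.indepFun_finset (Finset.range k) {k} (by simp)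
    h.measurable_outcome
  exact h1.comp (φ := id)
    (ψ := fun y : ({k} : Finset ℕ) → Bool × Finset (Fin n) ↦ y ⟨k, Finset.mem_singleton_self k⟩)
    measurable_id (measurable_pi_apply _)

lemma IsRandomness.indepFun_outcomePrefix_idx (h : IsRandomness P n b K p coin batch idx) (k : ℕ) :
    IndepFun (outcomePrefix coin batch k) idx P :=
  (h.indep_idx.comp (φ := id)
    (ψ := fun (y : ℕ → Bool × Finset (Fin n)) (i : Finset.range k) ↦ y i) measurable_id
    (measurable_pi_lambda _ fun _ ↦ measurable_pi_apply _)).symm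

/-- Extension of finitely many outcomes to a sequence. -/
def extendOutcomes {k : ℕ} (y : Finset.range k → Bool × Finset (Fin n)) (i : ℕ) :
    Bool × Finset (Fin n) :=
  -- The default outcome is arbitrary: the first `k` iterations never read it.
  if h : i ∈ Finset.range k then y ⟨i, h⟩ else (true, ∅)

lemma extendOutcomes_outcomePrefix {k i : ℕ} (hi : i < k) (ξ : Ω) :
    extendOutcomes (outcomePrefix coin batch k ξ) i = (coin i ξ, batch i ξ) := by
  rw [extendOutcomes, dif_pos (Finset.mem_range.2 hi)]
  rfl

lemma IsRandomness.integral_gradCount (h : IsRandomness P n b K p coin batch idx) (m : ℕ) :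
    Integrable (fun ξ ↦ (gradCount n b (fun k ↦ coin k ξ) m : ℝ)) P ∧
      ∫ ξ, (gradCount n b (fun k ↦ coin k ξ) m : ℝ) ∂P
        = n + m * (p * n + (1 - p) * (2 * b)) := by
  have hint : ∀ k, Integrable (fun ξ ↦ if coin k ξ then (n : ℝ) else 2 * b) P := fun k ↦
    integrable_comp_of_finite (h.measurable_coin k) fun c ↦ if c then (n : ℝ) else 2 * b
  have hval : ∀ k, ∫ ξ, (if coin k ξ then (n : ℝ) else 2 * b) ∂P
      = p * n + (1 - p) * (2 * b) := by
    intro k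
    have := integral_comp_eq_sum (P := P) (h.measurable_coin k)
      fun c ↦ if c then (n : ℝ) else 2 * b
    rw [this, Fintype.sum_bool, h.coin_law, h.coin_false]
    simp
  have e : (fun ξ ↦ (gradCount n b (fun k ↦ coin k ξ) m : ℝ))
      = fun ξ ↦ (n : ℝ) + ∑ k ∈ Finset.range m, if coin k ξ then (n : ℝ) else 2 * b := by
    ext ξ
    simp [gradCount]
  have hsum := integrable_finsetSum (Finset.range m) fun k _ ↦ hint k
  rw [e]
  refine ⟨(integrable_const _).add hsum, ?_⟩
  rw [integral_add (integrable_const _) hsum, integral_finsetSum _ fun k _ ↦ hint k]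
  simp only [integral_const, probReal_univ, one_smul, hval, Finset.sum_const, Finset.card_range,
    nsmul_eq_mul]

end Expectation

/-! ### Telescoping and the random output -/

section Convergence

variable {E : Type*} [NormedAddCommGroup E] [NormedSpace ℝ E] [FiniteDimensional ℝ E]
  {M : Type*} [TopologicalSpace M] [ChartedSpace E M] [IsManifold 𝓘(ℝ, E) ∞ M]
  [RiemannianBundle (fun x : M ↦ TangentSpace 𝓘(ℝ, E) x)] {n b K : ℕ}

lemma iterate_congr (f : Fin n → M → ℝ) (η : ℝ) (x₀ : M) {coin coin' : ℕ → Bool}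
    {batch batch' : ℕ → Finset (Fin n)} {k : ℕ}
    (h : ∀ i < k, (coin i, batch i) = (coin' i, batch' i)) :
    iterate (E := E) f η x₀ coin batch k = iterate (E := E) f η x₀ coin' batch' k := by
  induction k with
  | zero => rfl
  | succ k ih =>
    have hk := Prod.ext_iff.1 (h k (Nat.lt_succ_self k))
    simp only at hk
    rw [iterate_succ, iterate_succ, ih fun i hi ↦ h i (Nat.lt_succ_of_lt hi), hk.1, hk.2]

/-- The norm of the gradient of the objective at the base point of a tangent vector. -/
def gradNorm (f : Fin n → M → ℝ) (s : TangentBundle 𝓘(ℝ, E) M) : ℝ :=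
  ‖batchGrad (E := E) f Finset.univ s.proj‖

/-- The `k`-th iterate as a function of the first `m` outcomes. -/
def iterateOfPrefix (f : Fin n → M → ℝ) (η : ℝ) (x₀ : M) {m : ℕ}
    (y : Finset.range m → Bool × Finset (Fin n)) (k : ℕ) : TangentBundle 𝓘(ℝ, E) M :=
  iterate (E := E) f η x₀ (fun i ↦ (extendOutcomes y i).1) (fun i ↦ (extendOutcomes y i).2) k

variable {Ω : Type*} [MeasurableSpace Ω] {P : Measure Ω} [IsProbabilityMeasure P] {p : ℝ}
  {coin : ℕ → Ω → Bool} {batch : ℕ → Ω → Finset (Fin n)} {idx : Ω → Fin K}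

lemma iterateOfPrefix_outcomePrefix (f : Fin n → M → ℝ) (η : ℝ) (x₀ : M) {k m : ℕ} (hkm : k ≤ m)
    (ξ : Ω) : iterateOfPrefix (E := E) f η x₀ (outcomePrefix coin batch m ξ) k
      = iterate (E := E) f η x₀ (fun i ↦ coin i ξ) (fun i ↦ batch i ξ) k :=
  iterate_congr f η x₀ fun _ hi ↦ extendOutcomes_outcomePrefix (hi.trans_le hkm) ξ

/-- The iterate takes finitely many values, so `Φ` may be arbitrary. -/
lemma IsRandomness.integrable_iterate (h : IsRandomness P n b K p coin batch idx)
    (f : Fin n → M → ℝ) (η : ℝ) (x₀ : M) (k : ℕ) (Φ : TangentBundle 𝓘(ℝ, E) M → ℝ) :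
    Integrable (fun ξ ↦ Φ (iterate f η x₀ (fun i ↦ coin i ξ) (fun i ↦ batch i ξ) k)) P := by
  have := integrable_comp_of_finite (P := P) (h.measurable_outcomePrefix k)
    fun y ↦ Φ (iterateOfPrefix f η x₀ y k)
  simpa only [iterateOfPrefix_outcomePrefix f η x₀ le_rfl] using this

variable [IsContMDiffRiemannianBundle 𝓘(ℝ, E) ∞ E (fun x : M ↦ TangentSpace 𝓘(ℝ, E) x)]

lemma IsRandomness.integral_potential_succ_le (h : IsRandomness P n b K p coin batch idx)
    (hM : IsGeodesicallyComplete E M) (hn : n ≠ 0)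
    (hb : 1 ≤ b) (hbn : b ≤ n) {L : ℝ} {f : Fin n → M → ℝ}
    (hf : ∀ i, IsGSmooth E L (f i)) (fstar : ℝ) {η : ℝ} (hη : 0 < η) (hp : 0 < p) (hp1 : p ≤ 1)
    (hstep : (1 - p) / (p * b) * (L * η) ^ 2 ≤ 1 - L * η) (x₀ : M) (k : ℕ) :
    ∫ ξ, potential f fstar η p
        (iterate (E := E) f η x₀ (fun i ↦ coin i ξ) (fun i ↦ batch i ξ) (k + 1)) ∂P
      ≤ ∫ ξ, potential f fstar η p
          (iterate (E := E) f η x₀ (fun i ↦ coin i ξ) (fun i ↦ batch i ξ) k) ∂P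
        - η / 2 * ∫ ξ, gradNorm f
        (iterate (E := E) f η x₀ (fun i ↦ coin i ξ) (fun i ↦ batch i ξ) k) ^ 2 ∂P := by
  have key := integral_comp_le_of_indepFun (h.measurable_outcomePrefix k) (h.measurable_outcome k)
    (h.indepFun_outcomePrefix k)
    (F := fun y z ↦ potential f fstar η p
      (pageStep f η (iterateOfPrefix (E := E) f η x₀ y k) z.1 z.2))
    (G := fun y ↦ potential f fstar η p (iterateOfPrefix (E := E) f η x₀ y k)
      - η / 2 * gradNorm f
        (iterateOfPrefix (E := E) f η x₀ y k) ^ 2)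
    (fun y ↦ by
      simp only [h.outcome_law k]
      exact sum_outcomeWeight_mul_potential_le hM hn hb hbn hf fstar hη hp hp1 hstep _)
  simp only [iterateOfPrefix_outcomePrefix f η x₀ le_rfl] at key
  have i1 := h.integrable_iterate (E := E) f η x₀ k (potential f fstar η p)
  have i2 := h.integrable_iterate (E := E) f η x₀ k
    fun s ↦ gradNorm f s ^ 2
  rw [integral_sub i1 (i2.const_mul _), integral_const_mul] at key
  exact key

/-- The one-step decreases telescope. The potential starts at f(x⁰) − f*, as the first estimator is
exact, and never becomes negative. -/
lemma IsRandomness.sum_integral_norm_sq_le (h : IsRandomness P n b K p coin batch idx)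
    (hM : IsGeodesicallyComplete E M) (hn : n ≠ 0)
    (hb : 1 ≤ b) (hbn : b ≤ n) {L : ℝ} {f : Fin n → M → ℝ}
    (hf : ∀ i, IsGSmooth E L (f i)) {fstar : ℝ} (hfstar : ∀ x, fstar ≤ objective f x)
    {η : ℝ} (hη : 0 < η) (hp : 0 < p) (hp1 : p ≤ 1)
    (hstep : (1 - p) / (p * b) * (L * η) ^ 2 ≤ 1 - L * η) (x₀ : M) (m : ℕ) :
    η / 2 * ∑ k ∈ Finset.range m, ∫ ξ, gradNorm f
        (iterate (E := E) f η x₀ (fun i ↦ coin i ξ) (fun i ↦ batch i ξ) k) ^ 2 ∂P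
      ≤ objective f x₀ - fstar := by
  set a : ℕ → ℝ := fun k ↦ ∫ ξ, potential f fstar η p
    (iterate (E := E) f η x₀ (fun i ↦ coin i ξ) (fun i ↦ batch i ξ) k) ∂P with ha
  have h0 : a 0 = objective f x₀ - fstar := by
    have : ∀ ξ : Ω, potential f fstar η p
        (iterate (E := E) f η x₀ (fun i ↦ coin i ξ) (fun i ↦ batch i ξ) 0)
        = objective f x₀ - fstar := by
      intro ξ
      have h1 : gradError f (iterate (E := E) f η x₀ (fun i ↦ coin i ξ) (fun i ↦ batch i ξ) 0)
        = ‖batchGrad (E := E) f Finset.univ x₀ - batchGrad f Finset.univ x₀‖ ^ 2 := rfl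
      rw [potential, h1, sub_self, norm_zero, zero_pow two_ne_zero, mul_zero, add_zero]
      rfl
    simp [ha, this]
  have hm : 0 ≤ a m := by
    refine integral_nonneg fun ξ ↦ ?_
    have h1 := hfstar
      (iterate (E := E) f η x₀ (fun i ↦ coin i ξ) (fun i ↦ batch i ξ) m).proj
    have h2 : 0 ≤ η / (2 * p) * gradError f
        (iterate (E := E) f η x₀ (fun i ↦ coin i ξ) (fun i ↦ batch i ξ) m) :=
      mul_nonneg (by positivity) (sq_nonneg _)
    exact add_nonneg (sub_nonneg.2 h1) h2
  have hsum : η / 2 * ∑ k ∈ Finset.range m, ∫ ξ, gradNorm f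
        (iterate (E := E) f η x₀ (fun i ↦ coin i ξ) (fun i ↦ batch i ξ) k) ^ 2 ∂P
      ≤ ∑ k ∈ Finset.range m, (a k - a (k + 1)) := by
    rw [Finset.mul_sum]
    refine Finset.sum_le_sum fun k _ ↦ ?_
    have := h.integral_potential_succ_le hM hn hb hbn hf fstar hη hp hp1 hstep x₀ k
    simp only [ha]
    linarith
  rw [Finset.sum_range_sub'] at hsum
  linarith

lemma IsRandomness.integral_norm_output_le (h : IsRandomness P n b K p coin batch idx)
    (hK : 0 < K) (hM : IsGeodesicallyComplete E M) (hn : n ≠ 0)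
    (hb : 1 ≤ b) (hbn : b ≤ n) {L : ℝ} {f : Fin n → M → ℝ}
    (hf : ∀ i, IsGSmooth E L (f i)) {fstar : ℝ} (hfstar : ∀ x, fstar ≤ objective f x)
    {η : ℝ} (hη : 0 < η) (hp : 0 < p) (hp1 : p ≤ 1)
    (hstep : (1 - p) / (p * b) * (L * η) ^ 2 ≤ 1 - L * η) (x₀ : M) {ε : ℝ} (hε : 0 < ε)
    (hKε : 2 * (objective f x₀ - fstar) / (η * ε ^ 2) ≤ K) :
    Integrable (fun ξ ↦ ‖riemGrad (E := E) (objective f)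
      (output E f η x₀ (fun k ↦ coin k ξ) (fun k ↦ batch k ξ) (idx ξ))‖) P ∧
    ∫ ξ, ‖riemGrad (E := E) (objective f)
      (output E f η x₀ (fun k ↦ coin k ξ) (fun k ↦ batch k ξ) (idx ξ))‖ ∂P ≤ ε := by
  have hgrad : ∀ x, riemGrad (E := E) (objective f) x = batchGrad f Finset.univ x :=
    riemGrad_objective fun i ↦ (hf i).1
  simp only [hgrad]
  set N : TangentBundle 𝓘(ℝ, E) M → ℝ := gradNorm f with hN
  have hout : ∀ ξ, ‖batchGrad (E := E) f Finset.univ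
      (output E f η x₀ (fun k ↦ coin k ξ) (fun k ↦ batch k ξ) (idx ξ))‖
      = N (iterateOfPrefix f η x₀ (outcomePrefix coin batch K ξ) (idx ξ)) := by
    intro ξ
    rw [iterateOfPrefix_outcomePrefix f η x₀ (idx ξ).2.le]
    rfl
  simp only [hout]
  have hK' : (0 : ℝ) < K := by exact_mod_cast hK
  refine ⟨integrable_comp_of_finite ((h.measurable_outcomePrefix K).prodMk h.measurable_idx)
    fun y ↦ N (iterateOfPrefix f η x₀ y.1 y.2), ?_⟩
  have key := integral_comp_le_of_indepFun (h.measurable_outcomePrefix K) h.measurable_idx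
    (h.indepFun_outcomePrefix_idx K)
    (F := fun y j ↦ N (iterateOfPrefix (E := E) f η x₀ y j))
    -- The bound r ≤ ε/2 + r²/(2ε) passes from squared norms to norms in place of Jensen's
    -- inequality; it is an equality at r = ε, so no constant is lost.
    (G := fun y ↦ ε / 2 + (2 * ε * K)⁻¹ *
      ∑ j : Fin K, N (iterateOfPrefix (E := E) f η x₀ y j) ^ 2)
    (fun y ↦ by
      have hj : ∀ j ∈ Finset.univ, P.real {ξ | idx ξ = j} * N (iterateOfPrefix f η x₀ y j)
          ≤ 1 / K * (ε / 2) + (2 * ε * K)⁻¹ * N (iterateOfPrefix f η x₀ y j) ^ 2 := by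
        intro j _
        rw [h.idx_law]
        set r := N (iterateOfPrefix f η x₀ y j)
        have h1 : r ≤ ε / 2 + r ^ 2 / (2 * ε) := by
          rw [← sub_nonneg]
          have : ε / 2 + r ^ 2 / (2 * ε) - r = (r - ε) ^ 2 / (2 * ε) := by
            field_simp
            ring
          rw [this]
          positivity
        calc 1 / K * r ≤ 1 / K * (ε / 2 + r ^ 2 / (2 * ε)) := by gcongr
          _ = _ := by field_simp
      refine (Finset.sum_le_sum hj).trans (le_of_eq ?_)
      rw [Finset.sum_add_distrib, Finset.sum_const, Finset.card_univ, Fintype.card_fin,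
        nsmul_eq_mul, ← Finset.mul_sum]
      congr 1
      field_simp)
  refine key.trans ?_
  have hit : ∀ ξ, ∑ j : Fin K, N (iterateOfPrefix f η x₀ (outcomePrefix coin batch K ξ) j) ^ 2
      = ∑ k ∈ Finset.range K,
        N (iterate f η x₀ (fun i ↦ coin i ξ) (fun i ↦ batch i ξ) k) ^ 2 := by
    intro ξ
    rw [Finset.sum_range]
    refine Finset.sum_congr rfl fun j _ ↦ ?_
    rw [iterateOfPrefix_outcomePrefix f η x₀ j.2.le]
  simp only [hit]
  have hint : ∀ k ∈ Finset.range K, Integrable (fun ξ ↦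
      N (iterate f η x₀ (fun i ↦ coin i ξ) (fun i ↦ batch i ξ) k) ^ 2) P := fun k _ ↦
    h.integrable_iterate f η x₀ k fun s ↦ N s ^ 2
  rw [integral_add (integrable_const _) ((integrable_finsetSum _ hint).const_mul _),
    integral_const_mul, integral_finsetSum _ hint, integral_const, probReal_univ, one_smul]
  have hs := h.sum_integral_norm_sq_le hM hn hb hbn hf hfstar hη hp hp1 hstep x₀ K
  rw [div_le_iff₀ (by positivity)] at hKε
  set Q := ∑ k ∈ Finset.range K, ∫ ξ,
    N (iterate f η x₀ (fun i ↦ coin i ξ) (fun i ↦ batch i ξ) k) ^ 2 ∂P with hQ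
  have hs' : η / 2 * Q ≤ objective f x₀ - fstar := hs
  have hQle : Q ≤ K * ε ^ 2 := by
    have : η * Q ≤ η * (K * ε ^ 2) := by linarith
    exact le_of_mul_le_mul_left this hη
  calc ε / 2 + (2 * ε * K)⁻¹ * Q ≤ ε / 2 + (2 * ε * K)⁻¹ * (K * ε ^ 2) := by gcongr
    _ = ε := by field_simp; norm_num

end Convergence

/-! ### Step size and gradient count -/

section Parameters

/-- The number of iterations of R-PAGE for the accuracy `ε`. -/
def iterationCount (δ η ε : ℝ) : ℕ := max 1 ⌈2 * δ / (η * ε ^ 2)⌉₊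

lemma iterationCount_le {δ η ε : ℝ} (hδ : 0 ≤ δ) (hη : 0 < η) :
    (iterationCount δ η ε : ℝ) ≤ 1 + 2 * δ / (η * ε ^ 2) := by
  have h : 0 ≤ 2 * δ / (η * ε ^ 2) := by positivity
  rw [iterationCount, Nat.cast_max, max_le_iff]
  exact ⟨by simpa using h, by linarith [Nat.ceil_lt_add_one h]⟩

lemma le_iterationCount (δ η ε : ℝ) : 2 * δ / (η * ε ^ 2) ≤ iterationCount δ η ε :=
  (Nat.le_ceil _).trans (by exact_mod_cast le_max_right _ _)

lemma sqrt_ratio_eq {n b p : ℝ} (hn : 0 < n) (hb : 0 < b) (hp : p = b / (n + b)) :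
    √((1 - p) / (p * b)) = √n / b := by
  have h : (1 - p) / (p * b) = n / b ^ 2 := by
    rw [hp]
    field_simp
    ring
  rw [h, Real.sqrt_div hn.le, Real.sqrt_sq hb.le]

/-- With r the square root, Lη = 1/(1 + r), and the slack in the inequality is r/(1 + r)². -/
lemma stepsize_condition {L p b η : ℝ} (hL : 0 < L) (hr : 0 ≤ (1 - p) / (p * b))
    (hη : η = 1 / (L * (1 + √((1 - p) / (p * b))))) :
    (1 - p) / (p * b) * (L * η) ^ 2 ≤ 1 - L * η := by
  set r := √((1 - p) / (p * b)) with hrdef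
  have hr0 : 0 ≤ r := Real.sqrt_nonneg _
  have hsq : (1 - p) / (p * b) = r ^ 2 := (Real.sq_sqrt hr).symm
  have hLη : L * η = 1 / (1 + r) := by
    rw [hη]
    field_simp
  rw [hsq, hLη, ← sub_nonneg]
  have : 1 - 1 / (1 + r) - r ^ 2 * (1 / (1 + r)) ^ 2 = r / (1 + r) ^ 2 := by
    field_simp
    ring
  rw [this]
  positivity

/-- The constant 12 is 3·4: at most 3b gradients per iteration on average, and 4Lδ√n/(bε²)
iterations beyond the first, as b + √n ≤ 2√n. The remaining n + 3b is at most 4n. -/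
lemma gradCount_bound {n b p L δ ε η K : ℝ} (hb : 1 ≤ b) (hbn : b ≤ √n) (hn : 1 ≤ n)
    (hL : 0 < L) (hδ : 0 ≤ δ) (hε : 0 < ε) (hp : p = b / (n + b))
    (hη : η = 1 / (L * (1 + √n / b))) (hK : K ≤ 1 + 2 * δ / (η * ε ^ 2)) (hK0 : 0 ≤ K) :
    n + K * (p * n + (1 - p) * (2 * b)) ≤ 12 * (n + L * δ * √n / ε ^ 2) := by
  have hb0 : 0 < b := by linarith
  have hn0 : 0 < n := by linarith
  have hsn : √n ≤ n := by
    rw [Real.sqrt_le_left hn0.le]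
    nlinarith
  have h1 : p * n + (1 - p) * (2 * b) ≤ 3 * b := by
    have : p * n + (1 - p) * (2 * b) = 3 * b * (n / (n + b)) := by
      rw [hp]
      field_simp
      ring
    rw [this]
    exact mul_le_of_le_one_right (by positivity) ((div_le_one (by positivity)).2 (by linarith))
  have h2 : 2 * δ / (η * ε ^ 2) ≤ 4 * (L * δ * √n / ε ^ 2) / b := by
    have e : 2 * δ / (η * ε ^ 2) = 2 * (L * δ / ε ^ 2) / b * (b + √n) := by
      rw [hη]
      field_simp
    rw [e]
    calc 2 * (L * δ / ε ^ 2) / b * (b + √n) ≤ 2 * (L * δ / ε ^ 2) / b * (√n + √n) := by gcongr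
      _ = 4 * (L * δ * √n / ε ^ 2) / b := by ring
  calc n + K * (p * n + (1 - p) * (2 * b)) ≤ n + K * (3 * b) := by gcongr
    _ ≤ n + (1 + 4 * (L * δ * √n / ε ^ 2) / b) * (3 * b) := by gcongr; linarith
    _ = n + 3 * b + 12 * (L * δ * √n / ε ^ 2) := by field_simp; ring
    _ ≤ _ := by linarith

end Parameters

end RPAGE

end

/-! ### Choice of the number of iterations and conclusion -/

theorem corollary5
    {E : Type*} [NormedAddCommGroup E] [NormedSpace ℝ E] [FiniteDimensional ℝ E]
    {M : Type*} [TopologicalSpace M] [T2Space M] [ChartedSpace E M] [IsManifold 𝓘(ℝ, E) ∞ M]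
    [RiemannianBundle (fun x : M ↦ TangentSpace 𝓘(ℝ, E) x)]
    [IsContMDiffRiemannianBundle 𝓘(ℝ, E) ∞ E (fun x : M ↦ TangentSpace 𝓘(ℝ, E) x)]
    (hM : RPAGE.IsGeodesicallyComplete E M)
    {n b : ℕ} (hb : 1 ≤ b) (hbn : (b : ℝ) ≤ √(n : ℝ))
    (f : Fin n → M → ℝ) {L : ℝ} (hL : 0 < L) (hf : ∀ i, RPAGE.IsGSmooth E L (f i))
    {fstar : ℝ} (hfstar : ∀ x, fstar ≤ RPAGE.objective f x)
    (x₀ : M) {ε : ℝ} (hε : 0 < ε)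
    {p η : ℝ} (hp : p = (b : ℝ) / ((n : ℝ) + b))
    (hη : η = 1 / (L * (1 + √((1 - p) / (p * b))))) :
    ∃ K : ℕ, 0 < K ∧
      ∀ {Ω : Type*} [MeasurableSpace Ω] (P : Measure Ω) [IsProbabilityMeasure P]
        (coin : ℕ → Ω → Bool) (batch : ℕ → Ω → Finset (Fin n)) (idx : Ω → Fin K),
        RPAGE.IsRandomness P n b K p coin batch idx →
        (Integrable (fun ξ ↦ ‖RPAGE.riemGrad (E := E) (RPAGE.objective f)
            (RPAGE.output E f η x₀ (fun k ↦ coin k ξ) (fun k ↦ batch k ξ) (idx ξ))‖) P ∧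
          ∫ ξ, ‖RPAGE.riemGrad (E := E) (RPAGE.objective f)
            (RPAGE.output E f η x₀ (fun k ↦ coin k ξ) (fun k ↦ batch k ξ) (idx ξ))‖ ∂P ≤ ε) ∧
        (Integrable (fun ξ ↦ (RPAGE.gradCount n b (fun k ↦ coin k ξ) K : ℝ)) P ∧
          ∫ ξ, (RPAGE.gradCount n b (fun k ↦ coin k ξ) K : ℝ) ∂P ≤
            12 * ((n : ℝ) + L * (RPAGE.objective f x₀ - fstar) * √(n : ℝ) / ε ^ 2)) := by
  have hb1 : (1 : ℝ) ≤ b := by exact_mod_cast hb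
  have hn1 : (1 : ℝ) ≤ n := Real.one_le_sqrt.1 (hb1.trans hbn)
  have hn : n ≠ 0 := by
    rintro rfl
    norm_num at hn1
  have hbn' : b ≤ n := by
    have : (b : ℝ) ≤ n := hbn.trans
      ((Real.sqrt_le_left (by linarith)).2 (by nlinarith))
    exact_mod_cast this
  have hp0 : 0 < p := by
    rw [hp]
    positivity
  have hp1 : p ≤ 1 := by
    rw [hp, div_le_one (by positivity)]
    linarith
  have hη0 : 0 < η := by
    rw [hη]
    positivity
  have hδ : 0 ≤ RPAGE.objective f x₀ - fstar := sub_nonneg.2 (hfstar x₀)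
  have hstep := RPAGE.stepsize_condition hL
    (div_nonneg (sub_nonneg.2 hp1) (by positivity)) hη
  -- The descent condition needed η in terms of p; the gradient count needs √n/b.
  rw [RPAGE.sqrt_ratio_eq (by linarith) (by linarith) hp] at hη
  -- The count depends only on δ⁰, η and ε, so it is fixed before the probability space. Its lower
  -- bound 1 covers δ⁰ = 0.
  refine ⟨RPAGE.iterationCount (RPAGE.objective f x₀ - fstar) η ε,
    lt_of_lt_of_le one_pos (le_max_left _ _), fun P _ coin batch idx hR ↦ ⟨?_, ?_⟩⟩
  · exact hR.integral_norm_output_le (lt_of_lt_of_le one_pos (le_max_left _ _)) hM hn hb hbn' hf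
      hfstar hη0 hp0 hp1 hstep x₀ hε (RPAGE.le_iterationCount _ η ε)
  · obtain ⟨hint, hval⟩ := hR.integral_gradCount
      (RPAGE.iterationCount (RPAGE.objective f x₀ - fstar) η ε)
    refine ⟨hint, hval.le.trans ?_⟩
    exact RPAGE.gradCount_bound hb1 hbn hn1 hL hδ hε hp hη
      (RPAGE.iterationCount_le hδ hη0) (by positivity)
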